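/- Let $n\ge 2$ and let $\Sigma=\{\pm(e_i+e_j),\pm(e_i-e_j),\pm 2e_i \mid i\ne j\}\subset\mathbb{R}^n$ be the root system of type $C_n$, with simple roots $\Theta=\{\alpha_1,\dots,\alpha_n\}$, $\alpha_i=e_i-e_{i+1}$ for $i<n$ and $\alpha_n=2e_n$, positive roots $\Sigma^+$, and Weyl group $W$ generated by the simple reflections, equipped with its length function and Bruhat order $\le$. Let $\Theta_P,\Theta_Q\subseteq\Theta$, and let $W_P,W_Q\subseteq W$ be the subgroups generated by the corresponding simple reflections. Let $W^P$ and ${}^QW^P$ be the sets of minimal length representatives of $W/W_P$ and $W_Q\backslash W/W_P$, and for $w\in W$ let $\overline{w}\in W^P$ and $\widehat{w}\in{}^QW^P$ be the minimal length representatives of $wW_P$ and $W_QwW_P$. The parabolic moment graph $\mathcal{G}^P$ has vertex set $W^P$ and an edge $w\to\overline{s_\alpha w}$ labelled by $\alpha$ for all $w\in W^P$, $\alpha\in\Sigma^+$ with $w\le s_\alpha w$ and $\overline{w}\ne\overline{s_\alpha w}$. A double moment graph ${}^Q\mathcal{G}^P$ has vertex set ${}^QW^P$ and an edge $u\to u'$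 whenever $u\ne u'$ and there is $\beta\in\Sigma^+$ with $u\le s_\beta u$ and $u'=\widehat{s_\beta u}$; each edge $u\to u'$ is labelled by one chosen root $l(u\to u')$ among these $\beta$. It is viewed as a subgraph $\mathcal{G}'$ of $\mathcal{G}^P$ whose vertices are the elements of ${}^QW^P$ and the elements $\overline{s_{l(u\to u')}u}$, and whose edges are $u\to\overline{s_{l(u\to u')}u}$ with label $l(u\to u')$, for all edges $u\to u'$ of ${}^Q\mathcal{G}^P$. Let $W_Q$ act on $W^P$ by $w(x)=\overline{wx}$. The closure of ${}^Q\mathcal{G}^P$ is the subgraph of $\mathcal{G}^P$ whose vertices are the $w(x)$ with $w\in W_Q$ and $x$ a vertex of $\mathcal{G}'$, and whose edges are: all edges of $\mathcal{G}^P$ of the form $w(x)\to v(x)$ with $w,v\in W_Q$ and $x$ a vertex of $\mathcal{G}'$; and, for every edge $x\to y$ of $\mathcal{G}'$ with label $\alpha$ and every $w\in W_Q$, the edge $w(x)\to w(y)$ with label $w(\alpha)$ if $w(\alpha)\in\Sigma^+$, and the edge $w(y)\to w(x)$ with label $-w(\alpha)$ if $-w(\alpha)\in\Sigma^+$. The double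 moment graph ${}^Q\mathcal{G}^P$ is called closed if its closure equals $\mathcal{G}^P$. Proposition. For every choice of labels, the double moment graph ${}^Q\mathcal{G}^P$ is closed if and only if at least one of the following holds: - there exist $p,q$ with $1\le p,q\le n$ such that $\Theta_P=\{\alpha_p,\dots,\alpha_n\}$ and $\Theta_Q=\{\alpha_q,\dots,\alpha_n\}$; - $\alpha_n\notin\Theta_P$ and $\alpha_n\notin\Theta_Q$; - $\Theta_P=\Theta$ or $\Theta_Q=\Theta$; - $\Theta_P=\emptyset$ or $\Theta_Q=\emptyset$. -/

import Mathlib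

noncomputable section

namespace TypeC

/-! ### The root system of type `C_n` and its Weyl group

Simple roots are indexed from `0`: the index `i : Fin n` stands for the `(i + 1)`-st simple root.
Subsets of the set of simple roots are given as sets of indices. -/

/-- The ambient Euclidean space `ℝⁿ`. -/
abbrev Space (n : ℕ) : Type := EuclideanSpace ℝ (Fin n)

/-- Linear isometries of the ambient space; the Weyl group is a subgroup of this group. -/
abbrev Isom (n : ℕ) : Type := Space n ≃ₗᵢ[ℝ] Space n

/-- The standard basis vector `e_i`. -/
def e {n : ℕ} (i : Fin n) : Space n := EuclideanSpace.single i (1 : ℝ)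

/-- The roots of type `C_n`: `±(e_i + e_j)`, `±(e_i - e_j)` for `i ≠ j`, and `±2 e_i`. -/
def roots (n : ℕ) : Set (Space n) :=
  {α | (∃ i j : Fin n, i ≠ j ∧
          (α = e i + e j ∨ α = -(e i + e j) ∨ α = e i - e j ∨ α = -(e i - e j))) ∨
       ∃ i : Fin n, α = (2 : ℝ) • e i ∨ α = -((2 : ℝ) • e i)}

/-- The simple roots `e_1 - e_2, …, e_{n-1} - e_n, 2 e_n`. -/
def simpleRoot {n : ℕ} (i : Fin n) : Space n :=
  if h : (i : ℕ) + 1 < n then e i - e ⟨(i : ℕ) + 1, h⟩ else (2 : ℝ) • e i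

/-- The positive roots: the roots that are nonnegative integral combinations of simple roots. -/
def posRoots (n : ℕ) : Set (Space n) :=
  {α | α ∈ roots n ∧ ∃ c : Fin n → ℕ, α = ∑ i, (c i : ℝ) • simpleRoot i}

/-- The reflection `s_α` in the hyperplane orthogonal to `α`. -/
def refl {n : ℕ} (α : Space n) : Isom n := (Submodule.span ℝ {α})ᗮ.reflection

/-- The subgroup `W_J` generated by the simple reflections with index in `J`. -/
def parabolic {n : ℕ} (J : Set (Fin n)) : Subgroup (Isom n) :=
  Subgroup.closure ((fun i => refl (simpleRoot i)) '' J)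

/-- The Weyl group `W`. -/
def weyl (n : ℕ) : Subgroup (Isom n) := parabolic Set.univ

/-- The length of `w ∈ W`: the least length of a word in the simple reflections
with product `w`. -/
def length {n : ℕ} (w : Isom n) : ℕ :=
  sInf {k | ∃ l : List (Fin n), l.length = k ∧ (l.map fun i => refl (simpleRoot i)).prod = w}

/-- The Bruhat order `≤` on `W`: the reflexive transitive closure of the relations
`x < s_α x` for roots `α` with `ℓ(x) < ℓ(s_α x)`. -/
def BruhatLE {n : ℕ} : Isom n → Isom n → Prop :=
  Relation.ReflTransGen fun x y =>
    x ∈ weyl n ∧ ∃ α ∈ roots n, y = refl α * x ∧ length x < length y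

/-! ### Minimal coset representatives -/

/-- The left coset `w W_P`. -/
def leftCoset {n : ℕ} (P : Set (Fin n)) (w : Isom n) : Set (Isom n) :=
  {x | ∃ b ∈ parabolic P, x = w * b}

/-- The double coset `W_Q w W_P`. -/
def doubleCoset {n : ℕ} (Q P : Set (Fin n)) (w : Isom n) : Set (Isom n) :=
  {x | ∃ a ∈ parabolic Q, ∃ b ∈ parabolic P, x = a * w * b}

/-- The set `W^P` of minimal length representatives of the cosets in `W / W_P`. -/
def minLeft {n : ℕ} (P : Set (Fin n)) : Set (Isom n) :=
  {w | w ∈ weyl n ∧ ∀ x ∈ leftCoset P w, length w ≤ length x}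

/-- The set `^Q W^P` of minimal length representatives of the double cosets in
`W_Q \ W / W_P`. -/
def minDouble {n : ℕ} (Q P : Set (Fin n)) : Set (Isom n) :=
  {w | w ∈ weyl n ∧ ∀ x ∈ doubleCoset Q P w, length w ≤ length x}

theorem leftCoset_nonempty {n : ℕ} (P : Set (Fin n)) (w : Isom n) :
    (leftCoset P w).Nonempty :=
  ⟨w, 1, one_mem _, by simp⟩

theorem doubleCoset_nonempty {n : ℕ} (Q P : Set (Fin n)) (w : Isom n) :
    (doubleCoset Q P w).Nonempty :=
  ⟨w, 1, one_mem _, 1, one_mem _, by simp⟩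

/-- The element of minimal length in `w W_P`, usually written `w` with a bar. -/
def bar {n : ℕ} (P : Set (Fin n)) (w : Isom n) : Isom n :=
  Function.argminOn length (leftCoset P w) (leftCoset_nonempty P w)

/-- The element of minimal length in `W_Q w W_P`, usually written `w` with a hat. -/
def hat {n : ℕ} (Q P : Set (Fin n)) (w : Isom n) : Isom n :=
  Function.argminOn length (doubleCoset Q P w) (doubleCoset_nonempty Q P w)

/-! ### Moment graphs -/

/-- The underlying data of a moment graph whose vertices lie in `W`: a set of vertices and a set
of directed labelled edges, where `(x, α, y)` is the edge `x → y` with label `α`.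
The vertices are partially ordered by the Bruhat order. -/
@[ext]
structure MomentGraph (n : ℕ) where
  verts : Set (Isom n)
  edges : Set (Isom n × Space n × Isom n)

/-- The parabolic moment graph `G^P`. -/
def parabolicGraph {n : ℕ} (P : Set (Fin n)) : MomentGraph n where
  verts := minLeft P
  edges := {t | ∃ w ∈ minLeft P, ∃ α ∈ posRoots n,
    BruhatLE w (refl α * w) ∧ bar P w ≠ bar P (refl α * w) ∧ t = (w, α, bar P (refl α * w))}

/-- `β` is one of the possible labels of the edge `u → u'` on `^Q W^P`. -/
def IsPossibleLabel {n : ℕ} (Q P : Set (Fin n)) (u u' : Isom n) (β : Space n) : Prop :=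
  β ∈ posRoots n ∧ u' = hat Q P (refl β * u) ∧ BruhatLE u (refl β * u)

/-- The edges `u → u'` of a double moment graph. -/
def doubleEdges {n : ℕ} (Q P : Set (Fin n)) : Set (Isom n × Isom n) :=
  {t | t.1 ∈ minDouble Q P ∧ t.1 ≠ t.2 ∧ ∃ β, IsPossibleLabel Q P t.1 t.2 β}

/-- A `(P, Q)`-double moment graph: its vertices (the elements of `^Q W^P`) and its edges are
determined by `P` and `Q`, and it is given by choosing, for each edge, one of the possible
labels. -/
structure DoubleMomentGraph {n : ℕ} (Q P : Set (Fin n)) where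
  label : doubleEdges Q P → Space n
  isPossibleLabel_label :
    ∀ t : doubleEdges Q P, IsPossibleLabel Q P t.1.1 t.1.2 (label t)

/-- A double moment graph viewed as a subgraph of `G^P`: an edge `u → u'` with label `α` becomes
the edge from `u` to the minimal representative of `s_α u W_P`, with the same label. -/
def DoubleMomentGraph.toParabolic {n : ℕ} {Q P : Set (Fin n)} (D : DoubleMomentGraph Q P) :
    MomentGraph n where
  verts := minDouble Q P ∪ {x | ∃ t : doubleEdges Q P, x = bar P (refl (D.label t) * t.1.1)}
  edges := {s | ∃ t : doubleEdges Q P,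
    s = (t.1.1, D.label t, bar P (refl (D.label t) * t.1.1))}

/-- The `W_Q`-closure of a subgraph `Γ` of `G^P`, where `w ∈ W_Q` acts on `W^P` by sending `x`
to the minimal representative of `w x W_P`. -/
def closureGraph {n : ℕ} (Q P : Set (Fin n)) (Γ : MomentGraph n) : MomentGraph n where
  verts := {y | ∃ w ∈ parabolic Q, ∃ x ∈ Γ.verts, y = bar P (w * x)}
  edges :=
    {t | t ∈ (parabolicGraph P).edges ∧ ∃ x ∈ Γ.verts, ∃ w ∈ parabolic Q, ∃ v ∈ parabolic Q,
        t.1 = bar P (w * x) ∧ t.2.2 = bar P (v * x)} ∪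
    {t | ∃ x α y, (x, α, y) ∈ Γ.edges ∧ ∃ w ∈ parabolic Q, w α ∈ posRoots n ∧
        t = (bar P (w * x), w α, bar P (w * y))} ∪
    {t | ∃ x α y, (x, α, y) ∈ Γ.edges ∧ ∃ w ∈ parabolic Q, -(w α) ∈ posRoots n ∧
        t = (bar P (w * y), -(w α), bar P (w * x))}

/-- A double moment graph is closed if its closure is the whole parabolic moment graph `G^P`. -/
def DoubleMomentGraph.IsClosed {n : ℕ} {Q P : Set (Fin n)} (D : DoubleMomentGraph Q P) : Prop :=
  closureGraph Q P D.toParabolic = parabolicGraph P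

end TypeC

end

open scoped RealInnerProductSpace

noncomputable section

namespace TypeC

/-! ### Reflections -/

section Reflections

variable {n : ℕ}

/-! A coset `w W_P` is the point `w (lam P)`, where `lam P` is dominant with stabilizer `W_P`; a
double coset is a `W_Q`-orbit of such points, and `W_Q` is the stabilizer of `lam Q`
(`bar_eq_bar_iff`, `hat_eq_hat_iff`). An edge of `G^P` becomes a point `y` with a positive root `α`
such that `⟪α, y⟫ > 0`. The closure always contains all vertices, and all edges with `⟪α, lam Q⟫ =
0`, because these stay inside one `W_Q`-orbit. Every other edge changes the orbit, and a double
moment graph keeps one of these for each joined pair of orbits. So closedness says that all edges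
from one orbit to another are `W_Q`-translates of each other. This is `SingleOrbit (lam Q) (u (lam
P))` for all `u` (`DoubleMomentGraph.isClosed_iff`), a condition symmetric in the two vectors.

The rest is a matter of coordinates. The `i`-th coordinate of `lam P` counts the `k ≥ i` outside
`P`; so a zero coordinate occurs iff the last index lies in `P`, and a repeated nonzero one iff `P`
is not closed upwards. If `x` has zero and nonzero coordinates and `y` a repeated nonzero one, a
sign change fixing `x` identifies the effects of a long and a short reflection on a translate of
`y`, and no orbit contains both roots (`exists_not_singleOrbit`). What this leaves is exactly the
four cases of the theorem: no repeated nonzero coordinates on either side (`Separated.singleOrbit`),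
no zero coordinates on either side (`NonvanishingOnBasis.singleOrbit`), one vector zero, or one
vector regular (`singleOrbit_of_injective`). -/

theorem refl_apply (α v : Space n) : refl α v = v - (2 * ⟪α, v⟫ / ⟪α, α⟫) • α := by
  rw [refl, Submodule.reflection_orthogonal_apply, Submodule.reflection_singleton_apply,
    neg_sub, real_inner_self_eq_norm_sq, ← Nat.cast_smul_eq_nsmul ℝ, smul_smul, mul_div_assoc]
  simp

theorem refl_self (α : Space n) : refl α α = -α :=
  Submodule.reflection_orthogonalComplement_singleton_eq_neg α

theorem refl_refl_apply (α v : Space n) : refl α (refl α v) = v :=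
  Submodule.reflection_reflection _ v

theorem refl_mul_self (α : Space n) : refl α * refl α = 1 :=
  Submodule.reflection_mul_reflection _

theorem refl_inv (α : Space n) : (refl α)⁻¹ = refl α :=
  Submodule.reflection_inv

theorem refl_neg (α : Space n) : refl (-α) = refl α := by
  ext1 v
  simp only [refl_apply, inner_neg_left, inner_neg_right, neg_neg]
  rw [smul_neg, ← neg_smul]
  congr 2
  ring

theorem refl_of_inner_eq_zero {α v : Space n} (h : ⟪α, v⟫ = 0) : refl α v = v := by
  simp [refl_apply, h]

theorem inner_map (g : Isom n) (v w : Space n) : ⟪g v, g w⟫ = ⟪v, w⟫ :=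
  g.inner_map_map v w

theorem inner_map_left (g : Isom n) (v w : Space n) : ⟪g v, w⟫ = ⟪v, g⁻¹ w⟫ := by
  rw [← inner_map g v]
  congr 1
  exact (g.apply_symm_apply w).symm

theorem inner_map_right (g : Isom n) (v w : Space n) : ⟪v, g w⟫ = ⟪g⁻¹ v, w⟫ := by
  rw [real_inner_comm, inner_map_left, real_inner_comm]

theorem inner_refl_left (α v w : Space n) : ⟪refl α v, w⟫ = ⟪v, refl α w⟫ := by
  rw [inner_map_left, refl_inv]

theorem inner_self_refl (α v : Space n) : ⟪α, refl α v⟫ = -⟪α, v⟫ := by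
  rw [← inner_refl_left, refl_self, inner_neg_left]

theorem refl_eq_self_iff {α v : Space n} : refl α v = v ↔ ⟪α, v⟫ = 0 := by
  refine ⟨fun h => ?_, refl_of_inner_eq_zero⟩
  have := inner_self_refl α v
  rw [h] at this
  linarith

theorem map_refl (g : Isom n) (α v : Space n) : g (refl α v) = refl (g α) (g v) := by
  simp [refl_apply]

theorem mul_refl (g : Isom n) (α : Space n) : g * refl α = refl (g α) * g := by
  ext1 v
  exact map_refl g α v

theorem refl_map (g : Isom n) (α : Space n) : refl (g α) = g * refl α * g⁻¹ := by
  rw [mul_refl, mul_inv_cancel_right]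

theorem inv_apply_self (g : Isom n) (v : Space n) : g⁻¹ (g v) = v := g.symm_apply_apply v

theorem apply_inv_self (g : Isom n) (v : Space n) : g (g⁻¹ v) = v := g.apply_symm_apply v

theorem inv_apply_eq {g : Isom n} {v w : Space n} : g⁻¹ v = w ↔ v = g w := by
  constructor
  · rintro rfl
    exact (apply_inv_self g v).symm
  · rintro rfl
    exact inv_apply_self g w

end Reflections

/-! ### Signed basis vectors -/

section SignedBasis

variable {n : ℕ}

theorem inner_e_left (i : Fin n) (v : Space n) : ⟪e i, v⟫ = v i := by
  simp [e, EuclideanSpace.inner_single_left]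

theorem e_apply (i j : Fin n) : (e i : Space n) j = if j = i then 1 else 0 := by
  simp [e]

theorem inner_e_e (i j : Fin n) : ⟪(e i : Space n), e j⟫ = if i = j then 1 else 0 := by
  rw [inner_e_left, e_apply]

/-- The vectors `±e_i`. -/
def signedBasis (n : ℕ) : Set (Space n) := {u | ∃ i, u = e i ∨ u = -e i}

theorem e_mem (i : Fin n) : e i ∈ signedBasis n := ⟨i, Or.inl rfl⟩

theorem neg_mem_signedBasis {u : Space n} (hu : u ∈ signedBasis n) : -u ∈ signedBasis n := by
  obtain ⟨i, rfl | rfl⟩ := hu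
  · exact ⟨i, Or.inr rfl⟩
  · exact ⟨i, Or.inl (neg_neg _)⟩

theorem inner_self_signedBasis {u : Space n} (hu : u ∈ signedBasis n) : ⟪u, u⟫ = 1 := by
  obtain ⟨i, rfl | rfl⟩ := hu
  · simp only [inner_e_e, if_true]
  · simp only [inner_neg_neg, inner_e_e, if_true]

theorem signedBasis_cases {u v : Space n} (hu : u ∈ signedBasis n) (hv : v ∈ signedBasis n) :
    u = v ∨ u = -v ∨ ⟪u, v⟫ = 0 := by
  obtain ⟨i, rfl | rfl⟩ := hu <;> obtain ⟨j, rfl | rfl⟩ := hv <;>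
    by_cases h : i = j <;> simp [inner_e_e, h]

theorem inner_eq_zero_of_ne {u v : Space n} (hu : u ∈ signedBasis n) (hv : v ∈ signedBasis n)
    (h₁ : u ≠ v) (h₂ : u ≠ -v) : ⟪u, v⟫ = 0 := by
  rcases signedBasis_cases hu hv with h | h | h
  · exact absurd h h₁
  · exact absurd h h₂
  · exact h

theorem ext_inner_signedBasis {v w : Space n} (h : ∀ u ∈ signedBasis n, ⟪u, v⟫ = ⟪u, w⟫) :
    v = w := by
  ext i
  simpa [inner_e_left] using h (e i) (e_mem i)

theorem mem_roots_iff {α : Space n} :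
    α ∈ roots n ↔ ∃ u ∈ signedBasis n, ∃ v ∈ signedBasis n, u ≠ -v ∧ α = u + v := by
  constructor
  · rintro (⟨i, j, hij, rfl | rfl | rfl | rfl⟩ | ⟨i, rfl | rfl⟩)
    · refine ⟨e i, e_mem i, e j, e_mem j, fun h => ?_, rfl⟩
      have := congrArg (fun v : Space n => v i) h
      simp [e_apply, hij] at this
    · refine ⟨-e i, neg_mem_signedBasis (e_mem i), -e j, neg_mem_signedBasis (e_mem j),
        fun h => ?_, by abel⟩
      have := congrArg (fun v : Space n => v i) h
      simp [e_apply, hij] at this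
    · refine ⟨e i, e_mem i, -e j, neg_mem_signedBasis (e_mem j), fun h => ?_, by abel⟩
      have := congrArg (fun v : Space n => v i) h
      simp [e_apply, hij] at this
    · refine ⟨-e i, neg_mem_signedBasis (e_mem i), e j, e_mem j, fun h => ?_, by abel⟩
      have := congrArg (fun v : Space n => v i) h
      simp [e_apply, hij] at this
    · refine ⟨e i, e_mem i, e i, e_mem i, fun h => ?_, two_smul _ _⟩
      have := congrArg (fun v : Space n => v i) h
      norm_num [e_apply] at this
    · refine ⟨-e i, neg_mem_signedBasis (e_mem i), -e i, neg_mem_signedBasis (e_mem i),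
        fun h => ?_, by rw [two_smul]; abel⟩
      have := congrArg (fun v : Space n => v i) h
      norm_num [e_apply] at this
  · rintro ⟨u, ⟨i, hu⟩, v, ⟨j, hv⟩, huv, rfl⟩
    by_cases hij : i = j
    · subst hij
      right
      refine ⟨i, ?_⟩
      rcases hu with rfl | rfl <;> rcases hv with rfl | rfl
      · exact Or.inl (two_smul _ _).symm
      · simp at huv
      · simp at huv
      · right
        rw [two_smul]
        abel
    · left
      refine ⟨i, j, hij, ?_⟩
      rcases hu with rfl | rfl <;> rcases hv with rfl | rfl
      · exact Or.inl rfl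
      · exact Or.inr (Or.inr (Or.inl (by abel)))
      · exact Or.inr (Or.inr (Or.inr (by abel)))
      · exact Or.inr (Or.inl (by abel))

theorem root_ne_zero {α : Space n} (h : α ∈ roots n) : α ≠ 0 := by
  obtain ⟨u, -, v, -, huv, rfl⟩ := mem_roots_iff.1 h
  exact fun h => huv (eq_neg_of_add_eq_zero_left h)

theorem neg_mem_roots {α : Space n} (h : α ∈ roots n) : -α ∈ roots n := by
  obtain ⟨u, hu, v, hv, huv, rfl⟩ := mem_roots_iff.1 h
  refine mem_roots_iff.2 ⟨-u, neg_mem_signedBasis hu, -v, neg_mem_signedBasis hv, ?_, by abel⟩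
  exact fun h => huv (neg_injective h)

theorem inner_add_self {u v : Space n} (hu : u ∈ signedBasis n) (hv : v ∈ signedBasis n)
    (huv : u ≠ -v) : ⟪u + v, u + v⟫ = 2 * ⟪u + v, u⟫ ∧ ⟪u + v, u⟫ ≠ 0 := by
  have h₁ := inner_self_signedBasis hu
  have h₂ := inner_self_signedBasis hv
  have h₃ := real_inner_comm u v
  rw [inner_add_add_self, inner_add_left]
  rcases signedBasis_cases hu hv with rfl | h | h
  · constructor <;> linarith
  · exact absurd h huv
  · constructor <;> linarith

theorem refl_add_left {u v : Space n} (hu : u ∈ signedBasis n) (hv : v ∈ signedBasis n)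
    (huv : u ≠ -v) : refl (u + v) u = -v := by
  obtain ⟨h₁, h₂⟩ := inner_add_self hu hv huv
  rw [refl_apply, h₁, div_self (mul_ne_zero two_ne_zero h₂), one_smul]
  abel

theorem refl_add_right {u v : Space n} (hu : u ∈ signedBasis n) (hv : v ∈ signedBasis n)
    (huv : u ≠ -v) : refl (u + v) v = -u := by
  rw [add_comm]
  exact refl_add_left hv hu fun h => huv (by rw [h, neg_neg])

theorem refl_add_of_inner_eq_zero {u v b : Space n} (h₁ : ⟪u, b⟫ = 0) (h₂ : ⟪v, b⟫ = 0) :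
    refl (u + v) b = b :=
  refl_of_inner_eq_zero (by rw [inner_add_left, h₁, h₂, add_zero])

/-- Isometries that permute the vectors `±e_i`. -/
def IsSigned (g : Isom n) : Prop := ∀ u ∈ signedBasis n, g u ∈ signedBasis n

theorem isSigned_refl {α : Space n} (hα : α ∈ roots n) : IsSigned (refl α) := by
  obtain ⟨u, hu, v, hv, huv, rfl⟩ := mem_roots_iff.1 hα
  intro b hb
  rcases signedBasis_cases hu hb with rfl | rfl | h₁
  · rw [refl_add_left hu hv huv]
    exact neg_mem_signedBasis hv
  · have := refl_add_left hu hv huv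
    rw [map_neg, neg_inj] at this
    rwa [this]
  rcases signedBasis_cases hv hb with rfl | rfl | h₂
  · rw [refl_add_right hu hv huv]
    exact neg_mem_signedBasis hu
  · have := refl_add_right hu hv huv
    rw [map_neg, neg_inj] at this
    rwa [this]
  · rwa [refl_add_of_inner_eq_zero h₁ h₂]

theorem IsSigned.map_mem_roots {g : Isom n} (hg : IsSigned g) {α : Space n}
    (hα : α ∈ roots n) : g α ∈ roots n := by
  obtain ⟨u, hu, v, hv, huv, rfl⟩ := mem_roots_iff.1 hα
  refine mem_roots_iff.2 ⟨g u, hg u hu, g v, hg v hv, fun h => huv ?_, map_add _ _ _⟩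
  rw [← map_neg] at h
  exact g.injective h

end SignedBasis

/-! ### Simple and positive roots -/

section SimpleRoots

variable {n : ℕ}

theorem simpleRoot_mem_roots (i : Fin n) : simpleRoot i ∈ roots n := by
  unfold simpleRoot
  split_ifs with h
  · refine Or.inl ⟨i, ⟨i + 1, h⟩, ?_, Or.inr (Or.inr (Or.inl rfl))⟩
    intro h'
    have := congrArg Fin.val h'
    simp at this
  · exact Or.inr ⟨i, Or.inl rfl⟩

theorem simpleRoot_mem_posRoots (i : Fin n) : simpleRoot i ∈ posRoots n :=
  ⟨simpleRoot_mem_roots i, Pi.single i 1, by simp [Pi.single_apply]⟩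

/-- The `k`-th fundamental coweight up to a positive scalar: `e_1 + ⋯ + e_k`. -/
def coweight (k : Fin n) : Space n := ∑ i ∈ Finset.Iic k, e i

theorem inner_e_coweight (i k : Fin n) : ⟪e i, coweight k⟫ = if i ≤ k then 1 else 0 := by
  simp [coweight, inner_sum, inner_e_e]

theorem inner_simpleRoot_coweight_of_ne {i k : Fin n} (h : i ≠ k) :
    ⟪simpleRoot i, coweight k⟫ = 0 := by
  have h' : (i : ℕ) ≠ k := fun h' => h (Fin.ext h')
  unfold simpleRoot
  split_ifs with hi
  · rw [inner_sub_left, inner_e_coweight, inner_e_coweight]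
    simp only [Fin.le_def]
    split_ifs <;> first | omega | simp
  · rw [real_inner_smul_left, inner_e_coweight, if_neg, mul_zero]
    rw [Fin.le_def]
    omega

theorem inner_simpleRoot_coweight_pos (i : Fin n) : 0 < ⟪simpleRoot i, coweight i⟫ := by
  unfold simpleRoot
  split_ifs with hi
  · rw [inner_sub_left, inner_e_coweight, inner_e_coweight]
    simp [Fin.le_def]
  · rw [real_inner_smul_left, inner_e_coweight]
    simp

/-- Coweights are dual to the simple roots up to positive scalars, so pairing reads off
coefficients; this takes the place of linear independence of the simple roots. -/
theorem inner_sum_simpleRoot_coweight (c : Fin n → ℝ) (k : Fin n) :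
    ⟪∑ i, c i • simpleRoot i, coweight k⟫ = c k * ⟪simpleRoot k, coweight k⟫ := by
  rw [sum_inner, Finset.sum_eq_single k]
  · exact real_inner_smul_left _ _ _
  · intro i _ hi
    rw [real_inner_smul_left, inner_simpleRoot_coweight_of_ne hi, mul_zero]
  · simp

/-- Nonnegative integral combinations of simple roots. -/
def simpleCone (n : ℕ) : AddSubmonoid (Space n) where
  carrier := {v | ∃ c : Fin n → ℕ, v = ∑ i, (c i : ℝ) • simpleRoot i}
  zero_mem' := ⟨0, by simp⟩
  add_mem' := by
    rintro _ _ ⟨c, rfl⟩ ⟨d, rfl⟩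
    exact ⟨c + d, by simp [add_smul, Finset.sum_add_distrib]⟩

theorem simpleRoot_mem_simpleCone (i : Fin n) : simpleRoot i ∈ simpleCone n :=
  (simpleRoot_mem_posRoots i).2

theorem e_sub_e_mem_simpleCone {i j : Fin n} (h : i ≤ j) : e i - e j ∈ simpleCone n := by
  obtain ⟨j, hj⟩ := j
  induction j with
  | zero =>
    have : i = ⟨0, hj⟩ := Fin.ext (Nat.le_zero.1 h)
    rw [this, sub_self]
    exact zero_mem _
  | succ j ih =>
    rcases Nat.lt_or_ge j i with h' | h'
    · have : i = ⟨j + 1, hj⟩ := Fin.ext (le_antisymm h h')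
      rw [this, sub_self]
      exact zero_mem _
    · have h₁ := ih (by omega) h'
      have h₂ := simpleRoot_mem_simpleCone (⟨j, by omega⟩ : Fin n)
      rw [simpleRoot, dif_pos hj] at h₂
      have := add_mem h₁ h₂
      rwa [sub_add_sub_cancel] at this

theorem two_smul_e_mem_simpleCone (i : Fin n) : (2 : ℝ) • e i ∈ simpleCone n := by
  have hn : n - 1 < n := by have := i.2; omega
  have h₁ : e i - e ⟨n - 1, hn⟩ ∈ simpleCone n := e_sub_e_mem_simpleCone (by
    rw [Fin.le_def]
    have := i.2
    simp only
    omega)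
  have h₂ := simpleRoot_mem_simpleCone (⟨n - 1, hn⟩ : Fin n)
  rw [simpleRoot, dif_neg (by simp only; omega)] at h₂
  have := add_mem (add_mem h₁ h₁) h₂
  convert this using 1
  rw [two_smul, two_smul]
  abel

theorem e_add_e_mem_simpleCone (i j : Fin n) : e i + e j ∈ simpleCone n := by
  wlog h : i ≤ j generalizing i j
  · rw [add_comm]
    exact this j i (le_of_not_ge h)
  have := add_mem (e_sub_e_mem_simpleCone h) (two_smul_e_mem_simpleCone j)
  rw [two_smul] at this
  convert this using 1
  abel

theorem mem_simpleCone_or_neg_mem {α : Space n} (h : α ∈ roots n) :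
    α ∈ simpleCone n ∨ -α ∈ simpleCone n := by
  rcases h with (⟨i, j, hij, rfl | rfl | rfl | rfl⟩ | ⟨i, rfl | rfl⟩)
  · exact Or.inl (e_add_e_mem_simpleCone i j)
  · rw [neg_neg]
    exact Or.inr (e_add_e_mem_simpleCone i j)
  · rw [neg_sub]
    rcases le_total i j with h | h
    · exact Or.inl (e_sub_e_mem_simpleCone h)
    · exact Or.inr (e_sub_e_mem_simpleCone h)
  · rw [neg_neg, neg_sub]
    rcases le_total i j with h | h
    · exact Or.inr (e_sub_e_mem_simpleCone h)
    · exact Or.inl (e_sub_e_mem_simpleCone h)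
  · exact Or.inl (two_smul_e_mem_simpleCone i)
  · rw [neg_neg]
    exact Or.inr (two_smul_e_mem_simpleCone i)

theorem mem_posRoots_or_neg_mem {α : Space n} (h : α ∈ roots n) :
    α ∈ posRoots n ∨ -α ∈ posRoots n :=
  (mem_simpleCone_or_neg_mem h).imp (fun h' => ⟨h, h'⟩) fun h' => ⟨neg_mem_roots h, h'⟩

theorem inner_coweight_nonneg {α : Space n} (h : α ∈ posRoots n) (k : Fin n) :
    0 ≤ ⟪α, coweight k⟫ := by
  obtain ⟨-, c, rfl⟩ := h
  rw [inner_sum_simpleRoot_coweight]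
  exact mul_nonneg (Nat.cast_nonneg _) (inner_simpleRoot_coweight_pos k).le

theorem eq_zero_of_inner_coweight {α : Space n} (h : α ∈ simpleCone n)
    (h' : ∀ k, ⟪α, coweight k⟫ = 0) : α = 0 := by
  obtain ⟨c, rfl⟩ := h
  refine Finset.sum_eq_zero fun k _ => ?_
  have := h' k
  rw [inner_sum_simpleRoot_coweight] at this
  rw [(mul_eq_zero.1 this).resolve_right (inner_simpleRoot_coweight_pos k).ne', zero_smul]

theorem neg_notMem_posRoots {α : Space n} (h : α ∈ posRoots n) : -α ∉ posRoots n := by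
  intro h'
  refine root_ne_zero h.1 (eq_zero_of_inner_coweight h.2 fun k => ?_)
  have h₁ := inner_coweight_nonneg h k
  have h₂ := inner_coweight_nonneg h' k
  rw [inner_neg_left] at h₂
  linarith

theorem inner_self_root {α : Space n} (h : α ∈ roots n) : ⟪α, α⟫ = 2 ∨ ⟪α, α⟫ = 4 := by
  obtain ⟨u, hu, v, hv, huv, rfl⟩ := mem_roots_iff.1 h
  have h₁ := inner_self_signedBasis hu
  have h₂ := inner_self_signedBasis hv
  rw [inner_add_add_self, real_inner_comm u v]
  rcases signedBasis_cases hu hv with rfl | h | h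
  · right
    linarith
  · exact absurd h huv
  · left
    linarith

/-- A simple reflection changes only the `i`-th coefficient. If the image were negative, all other
coefficients of `α` would vanish, and since squared root lengths are 2 or 4, `α` would be
`simpleRoot i` itself. -/
theorem refl_simpleRoot_mem_posRoots {α : Space n} (hα : α ∈ posRoots n) {i : Fin n}
    (hi : α ≠ simpleRoot i) : refl (simpleRoot i) α ∈ posRoots n := by
  have hr : refl (simpleRoot i) α ∈ roots n :=
    (isSigned_refl (simpleRoot_mem_roots i)).map_mem_roots hα.1
  refine (mem_posRoots_or_neg_mem hr).resolve_right fun hneg => hi ?_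
  have h₀ : ∀ k, k ≠ i → ⟪α, coweight k⟫ = 0 := by
    intro k hk
    have h₁ := inner_coweight_nonneg hα k
    have h₂ := inner_coweight_nonneg hneg k
    rw [inner_neg_left, inner_refl_left,
      refl_of_inner_eq_zero (inner_simpleRoot_coweight_of_ne hk.symm)] at h₂
    linarith
  obtain ⟨hαr, c, hc⟩ := hα
  have hα' : α = (c i : ℝ) • simpleRoot i := by
    rw [hc]
    refine Finset.sum_eq_single i (fun k _ hk => ?_) (by simp)
    have := h₀ k hk
    rw [hc, inner_sum_simpleRoot_coweight] at this
    rw [(mul_eq_zero.1 this).resolve_right (inner_simpleRoot_coweight_pos k).ne', zero_smul]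
  have h₁ := inner_self_root hαr
  have h₂ := inner_self_root (simpleRoot_mem_roots i)
  rw [hα', real_inner_smul_left, real_inner_smul_right] at h₁
  have hc1 : c i = 1 := by
    have hc2 : c i < 2 := by
      by_contra! h
      have : (2 : ℝ) ≤ c i := by exact_mod_cast h
      rcases h₁ with h₁ | h₁ <;> rcases h₂ with h₂ | h₂ <;> rw [h₂] at h₁ <;> nlinarith
    have hc0 : c i ≠ 0 := by
      intro h
      rw [h] at h₁
      norm_num at h₁
    omega
  rw [hα', hc1, Nat.cast_one, one_smul]

end SimpleRoots

/-! ### The Weyl group: words, length and exchange -/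

section Weyl

variable {n : ℕ}

/-- The product of simple reflections spelled by a word. -/
def word (l : List (Fin n)) : Isom n := (l.map fun i => refl (simpleRoot i)).prod

theorem word_nil : word ([] : List (Fin n)) = 1 := rfl

theorem word_cons (i : Fin n) (l : List (Fin n)) :
    word (i :: l) = refl (simpleRoot i) * word l := by
  simp [word]

theorem word_append (l l' : List (Fin n)) : word (l ++ l') = word l * word l' := by
  simp [word]

theorem word_inv (l : List (Fin n)) : (word l)⁻¹ = word l.reverse := by
  simp only [word, List.prod_inv_reverse, List.map_map, List.map_reverse]
  congr 3

theorem refl_mem_parabolic {J : Set (Fin n)} {i : Fin n} (hi : i ∈ J) :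
    refl (simpleRoot i) ∈ parabolic J :=
  Subgroup.subset_closure ⟨i, hi, rfl⟩

theorem word_mem_parabolic {J : Set (Fin n)} {l : List (Fin n)} (hl : ∀ i ∈ l, i ∈ J) :
    word l ∈ parabolic J := by
  refine Subgroup.list_prod_mem _ fun x hx => ?_
  obtain ⟨i, hi, rfl⟩ := List.mem_map.1 hx
  exact refl_mem_parabolic (hl i hi)

theorem exists_word {J : Set (Fin n)} {w : Isom n} (hw : w ∈ parabolic J) :
    ∃ l : List (Fin n), (∀ i ∈ l, i ∈ J) ∧ word l = w := by
  induction hw using Subgroup.closure_induction with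
  | mem x hx =>
    obtain ⟨i, hi, rfl⟩ := hx
    exact ⟨[i], by simpa using hi, by simp [word]⟩
  | one => exact ⟨[], by simp, rfl⟩
  | mul x y _ _ hx hy =>
    obtain ⟨l, hl, rfl⟩ := hx
    obtain ⟨l', hl', rfl⟩ := hy
    refine ⟨l ++ l', fun i hi => ?_, word_append l l'⟩
    exact (List.mem_append.1 hi).elim (hl i) (hl' i)
  | inv x _ hx =>
    obtain ⟨l, hl, rfl⟩ := hx
    exact ⟨l.reverse, by simpa using hl, (word_inv l).symm⟩

theorem parabolic_le_weyl (J : Set (Fin n)) : parabolic J ≤ weyl n :=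
  Subgroup.closure_mono (Set.image_mono (Set.subset_univ J))

theorem isSigned_of_mem_weyl {w : Isom n} (hw : w ∈ weyl n) : IsSigned w := by
  obtain ⟨l, -, rfl⟩ := exists_word hw
  induction l with
  | nil => exact fun u hu => hu
  | cons i l ih =>
    rw [word_cons]
    exact fun u hu => isSigned_refl (simpleRoot_mem_roots i) _
      (ih (word_mem_parabolic fun _ _ => trivial) u hu)

theorem map_mem_roots {w : Isom n} (hw : w ∈ weyl n) {α : Space n} (hα : α ∈ roots n) :
    w α ∈ roots n :=
  (isSigned_of_mem_weyl hw).map_mem_roots hα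

/-- Apply the letters to `α` from the right. Where the root first turns negative it was the simple
root of that letter, and deleting this letter amounts to multiplying by `refl α`. The word need not
be reduced. -/
theorem exchange {l : List (Fin n)} {α : Space n} (hα : α ∈ posRoots n)
    (hl : -(word l α) ∈ posRoots n) :
    ∃ l' : List (Fin n), l'.Sublist l ∧ l'.length < l.length ∧ word l * refl α = word l' := by
  induction l with
  | nil => exact absurd hl (neg_notMem_posRoots hα)
  | cons i l ih =>
    have hr : word l α ∈ roots n := map_mem_roots (word_mem_parabolic fun _ _ => trivial) hα.1
    rcases mem_posRoots_or_neg_mem hr with h | h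
    · have hi : word l α = simpleRoot i := by
        by_contra hne
        rw [word_cons] at hl
        exact neg_notMem_posRoots (refl_simpleRoot_mem_posRoots h hne) hl
      refine ⟨l, List.sublist_cons_self i l, by simp, ?_⟩
      rw [word_cons, mul_assoc, mul_refl, hi, ← mul_assoc, refl_mul_self, one_mul]
    · obtain ⟨l', h₁, h₂, h₃⟩ := ih h
      refine ⟨i :: l', h₁.cons_cons i, by simpa using h₂, ?_⟩
      rw [word_cons, word_cons, mul_assoc, h₃]

theorem length_word_le (l : List (Fin n)) : length (word l) ≤ l.length :=
  Nat.sInf_le ⟨l, rfl, rfl⟩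

/-- Membership in `weyl n` matters: on other isometries `length` is the infimum of the empty set,
hence 0. -/
theorem exists_reduced_word {w : Isom n} (hw : w ∈ weyl n) :
    ∃ l : List (Fin n), l.length = length w ∧ word l = w := by
  obtain ⟨l, -, hl⟩ := exists_word hw
  exact Nat.sInf_mem (s := {k | ∃ l : List (Fin n), l.length = k ∧ word l = w}) ⟨_, l, rfl, hl⟩

theorem length_inv_le {w : Isom n} (hw : w ∈ weyl n) : length w⁻¹ ≤ length w := by
  obtain ⟨l, hl, rfl⟩ := exists_reduced_word hw
  rw [← hl, word_inv, ← List.length_reverse]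
  exact length_word_le _

theorem length_inv {w : Isom n} (hw : w ∈ weyl n) : length w⁻¹ = length w := by
  refine le_antisymm (length_inv_le hw) ?_
  simpa using length_inv_le (inv_mem hw)

theorem length_mul_refl_lt {w : Isom n} (hw : w ∈ weyl n) {α : Space n} (hα : α ∈ posRoots n)
    (h : -(w α) ∈ posRoots n) : length (w * refl α) < length w := by
  obtain ⟨l, hl, rfl⟩ := exists_reduced_word hw
  obtain ⟨l', -, h₂, h₃⟩ := exchange hα h
  rw [← hl, h₃]
  exact (length_word_le l').trans_lt h₂

/-- Every element of `W_J` is obtained from `1` by multiplying on the right by simple reflections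
`s_i`, `i ∈ J`, increasing the length at each step. -/
theorem parabolic_induction {J : Set (Fin n)} {p : Isom n → Prop} (one : p 1)
    (mul : ∀ b ∈ parabolic J, ∀ i ∈ J, b (simpleRoot i) ∈ posRoots n → p b →
      p (b * refl (simpleRoot i)))
    {b : Isom n} (hb : b ∈ parabolic J) : p b := by
  suffices ∀ (k : ℕ) (l : List (Fin n)), (∀ i ∈ l, i ∈ J) → l.length = k → p (word l) by
    obtain ⟨l, hl, rfl⟩ := exists_word hb
    exact this _ l hl rfl
  intro k
  induction k using Nat.strong_induction_on with
  | _ k ih =>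
    intro l hl hk
    rcases List.eq_nil_or_concat l with rfl | ⟨l, i, rfl⟩
    · exact one
    · rw [List.concat_eq_append] at hl hk ⊢
      have hlJ : ∀ j ∈ l, j ∈ J := fun j hj => hl j (List.mem_append_left _ hj)
      have hi : i ∈ J := hl i (by simp)
      have hk' : l.length + 1 = k := by simpa using hk
      have hw : word (l ++ [i]) = word l * refl (simpleRoot i) := by
        rw [word_append, word_cons, word_nil, mul_one]
      rw [hw]
      have hr := map_mem_roots (w := word l) (word_mem_parabolic fun _ _ => trivial)
        (simpleRoot_mem_roots i)
      rcases mem_posRoots_or_neg_mem hr with h | h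
      · exact mul _ (word_mem_parabolic hlJ) i hi h (ih _ (by omega) l hlJ rfl)
      -- The last letter shortens the element, so exchange yields a shorter word; being a sublist,
      -- it still has its letters in `J`.
      · obtain ⟨l', h₁, h₂, h₃⟩ := exchange (simpleRoot_mem_posRoots i) h
        rw [h₃]
        exact ih _ (by omega) l' (fun j hj => hlJ j (h₁.subset hj)) rfl

/-- Conjugation leads from the simple reflections to all of them: neighbouring transpositions give
`e i - e j`, these carry `2 e i` to the last simple root, and the sign change at `j` turns `e i + e
j` into `e i - e j`. -/
theorem refl_mem_weyl_of_map {w : Isom n} (hw : w ∈ weyl n) {α : Space n}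
    (h : refl (w α) ∈ weyl n) : refl α ∈ weyl n := by
  rw [refl_map] at h
  have := mul_mem (mul_mem (inv_mem hw) h) hw
  simpa [mul_assoc] using this

theorem refl_sub_left {u v : Space n} (hu : u ∈ signedBasis n) (hv : v ∈ signedBasis n)
    (h : u ≠ v) : refl (u - v) u = v := by
  rw [sub_eq_add_neg, refl_add_left hu (neg_mem_signedBasis hv) (by rwa [neg_neg]), neg_neg]

theorem refl_sub_right {u v : Space n} (hu : u ∈ signedBasis n) (hv : v ∈ signedBasis n)
    (h : u ≠ v) : refl (u - v) v = u := by
  rw [← neg_sub, refl_neg, refl_sub_left hv hu h.symm]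

theorem e_injective : Function.Injective (e : Fin n → Space n) := by
  intro i j h
  by_contra hij
  have := congrArg (fun v : Space n => v i) h
  simp [e_apply, hij] at this

theorem e_ne_neg_e (i j : Fin n) : (e i : Space n) ≠ -e j := by
  intro h
  have := congrArg (fun v : Space n => v i) h
  simp only [e_apply, PiLp.neg_apply, if_true] at this
  split_ifs at this <;> norm_num at this

theorem refl_e_sub_e_mem_weyl {i j : Fin n} (h : i < j) : refl (e i - e j) ∈ weyl n := by
  obtain ⟨j, hj⟩ := j
  induction j with
  | zero => exact absurd h (Nat.not_lt_zero _)
  | succ j ih =>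
    have h₀ := refl_mem_parabolic (J := Set.univ) (Set.mem_univ (⟨j, by omega⟩ : Fin n))
    rw [simpleRoot, dif_pos hj] at h₀
    simp only at h₀
    rcases Nat.lt_or_ge i j with h' | h'
    · refine refl_mem_weyl_of_map h₀ ?_
      have h₁ : (⟨j, by omega⟩ : Fin n) ≠ ⟨j + 1, hj⟩ := by simp
      have h₂ : (⟨j, by omega⟩ : Fin n) ≠ i := fun h => by rw [← h] at h'; simp at h'
      have h₃ : (⟨j + 1, hj⟩ : Fin n) ≠ i := h.ne'
      rw [map_sub, refl_of_inner_eq_zero (v := e i)]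
      · rw [refl_sub_right (e_mem _) (e_mem _) (e_injective.ne h₁)]
        exact ih (by omega) h'
      · simp [inner_sub_left, inner_e_e, h₂, h₃]
    · have : i = ⟨j, by omega⟩ := Fin.ext (le_antisymm (Nat.lt_succ_iff.1 h) h')
      rwa [this]

theorem refl_e_sub_e_mem_weyl_of_ne {i j : Fin n} (h : i ≠ j) : refl (e i - e j) ∈ weyl n := by
  rcases lt_or_gt_of_ne h with h | h
  · exact refl_e_sub_e_mem_weyl h
  · rw [← neg_sub, refl_neg]
    exact refl_e_sub_e_mem_weyl h

theorem refl_two_smul_e_mem_weyl (i : Fin n) : refl ((2 : ℝ) • e i) ∈ weyl n := by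
  have hn : n - 1 < n := by have := i.2; omega
  have h₀ := refl_mem_parabolic (J := Set.univ) (Set.mem_univ (⟨n - 1, hn⟩ : Fin n))
  rw [simpleRoot, dif_neg (by simp only; omega)] at h₀
  by_cases hi : i = ⟨n - 1, hn⟩
  · rwa [hi]
  · refine refl_mem_weyl_of_map (refl_e_sub_e_mem_weyl_of_ne hi) ?_
    rw [map_smul, refl_sub_left (e_mem _) (e_mem _) (e_injective.ne hi)]
    exact h₀

theorem refl_e_add_e_mem_weyl {i j : Fin n} (h : i ≠ j) : refl (e i + e j) ∈ weyl n := by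
  refine refl_mem_weyl_of_map (refl_two_smul_e_mem_weyl j) ?_
  rw [map_add, two_smul, refl_add_left (e_mem j) (e_mem j) (e_ne_neg_e j j),
    refl_add_of_inner_eq_zero, ← sub_eq_add_neg]
  · exact refl_e_sub_e_mem_weyl_of_ne h
  all_goals rw [inner_e_e, if_neg h.symm]

theorem refl_mem_weyl {α : Space n} (h : α ∈ roots n) : refl α ∈ weyl n := by
  rcases h with (⟨i, j, hij, rfl | rfl | rfl | rfl⟩ | ⟨i, rfl | rfl⟩)
  · exact refl_e_add_e_mem_weyl hij
  · rw [refl_neg]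
    exact refl_e_add_e_mem_weyl hij
  · exact refl_e_sub_e_mem_weyl_of_ne hij
  · rw [refl_neg]
    exact refl_e_sub_e_mem_weyl_of_ne hij
  · exact refl_two_smul_e_mem_weyl i
  · rw [refl_neg]
    exact refl_two_smul_e_mem_weyl i

theorem refl_mul_mem_weyl {α : Space n} (h : α ∈ roots n) {w : Isom n} (hw : w ∈ weyl n) :
    refl α * w ∈ weyl n :=
  mul_mem (refl_mem_weyl h) hw

theorem length_refl_mul_lt {w : Isom n} (hw : w ∈ weyl n) {α : Space n} (hα : α ∈ posRoots n)
    (h : -(w⁻¹ α) ∈ posRoots n) : length (refl α * w) < length w := by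
  have h₁ := length_mul_refl_lt (inv_mem hw) hα h
  rwa [length_inv hw, ← refl_inv α, ← mul_inv_rev, length_inv (refl_mul_mem_weyl hα.1 hw)] at h₁

theorem length_lt_refl_mul {w : Isom n} (hw : w ∈ weyl n) {α : Space n} (hα : α ∈ posRoots n)
    (h : w⁻¹ α ∈ posRoots n) : length w < length (refl α * w) := by
  have h₁ := length_refl_mul_lt (refl_mul_mem_weyl hα.1 hw) hα (by
    rw [mul_inv_rev, refl_inv]
    change -(w⁻¹ (refl α α)) ∈ posRoots n
    rwa [refl_self, map_neg, neg_neg])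
  rwa [← mul_assoc, refl_mul_self, one_mul] at h₁

theorem length_le_of_bruhatLE {x y : Isom n} (h : BruhatLE x y) : x = y ∨ length x < length y := by
  induction h with
  | refl => exact Or.inl rfl
  | tail _ hyz ih =>
    obtain ⟨-, α, -, -, hlt⟩ := hyz
    rcases ih with rfl | ih
    · exact Or.inr hlt
    · exact Or.inr (ih.trans hlt)

/-- Comparing `w` with `refl α * w` is a matter of length, and the sign of `w⁻¹ α` decides which is
longer. The Bruhat order enters the moment graphs only through this criterion. -/
theorem bruhatLE_refl_mul_iff {w : Isom n} (hw : w ∈ weyl n) {α : Space n}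
    (hα : α ∈ posRoots n) : BruhatLE w (refl α * w) ↔ w⁻¹ α ∈ posRoots n := by
  constructor
  · intro h
    refine (mem_posRoots_or_neg_mem (map_mem_roots (inv_mem hw) hα.1)).resolve_right fun h' => ?_
    have h₁ := length_refl_mul_lt hw hα h'
    rcases length_le_of_bruhatLE h with h₂ | h₂
    · rw [← h₂] at h₁
      exact lt_irrefl _ h₁
    · exact lt_asymm h₁ h₂
  · intro h
    exact Relation.ReflTransGen.single ⟨hw, α, hα.1, rfl, length_lt_refl_mul hw hα h⟩

end Weyl

/-! ### Dominant vectors and minimal coset representatives -/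

section Dominant

variable {n : ℕ}

open Classical in
/-- A dominant vector whose stabilizer in `W` is `W_P`. -/
def lam (P : Set (Fin n)) : Space n := ∑ k, if k ∈ P then 0 else coweight k

theorem inner_simpleRoot_lam_of_mem {P : Set (Fin n)} {i : Fin n} (hi : i ∈ P) :
    ⟪simpleRoot i, lam P⟫ = 0 := by
  rw [lam, inner_sum]
  refine Finset.sum_eq_zero fun k _ => ?_
  split_ifs with hk
  · exact inner_zero_right _
  · exact inner_simpleRoot_coweight_of_ne fun h => hk (h ▸ hi)

theorem inner_simpleRoot_lam_pos {P : Set (Fin n)} {i : Fin n} (hi : i ∉ P) :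
    0 < ⟪simpleRoot i, lam P⟫ := by
  rw [lam, inner_sum, Finset.sum_eq_single i, if_neg hi]
  · exact inner_simpleRoot_coweight_pos i
  · intro k _ hk
    split_ifs
    · exact inner_zero_right _
    · exact inner_simpleRoot_coweight_of_ne hk.symm
  · simp

theorem inner_simpleRoot_lam_nonneg (P : Set (Fin n)) (i : Fin n) :
    0 ≤ ⟪simpleRoot i, lam P⟫ := by
  by_cases hi : i ∈ P
  · exact (inner_simpleRoot_lam_of_mem hi).ge
  · exact (inner_simpleRoot_lam_pos hi).le

theorem inner_lam_nonneg (P : Set (Fin n)) {α : Space n} (hα : α ∈ posRoots n) :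
    0 ≤ ⟪α, lam P⟫ := by
  obtain ⟨-, c, rfl⟩ := hα
  rw [sum_inner]
  refine Finset.sum_nonneg fun k _ => ?_
  rw [real_inner_smul_left]
  exact mul_nonneg (Nat.cast_nonneg _) (inner_simpleRoot_lam_nonneg P k)

theorem mem_posRoots_of_inner_lam_pos (P : Set (Fin n)) {α : Space n} (hα : α ∈ roots n)
    (h : 0 < ⟪α, lam P⟫) : α ∈ posRoots n := by
  refine (mem_posRoots_or_neg_mem hα).resolve_right fun h' => ?_
  have := inner_lam_nonneg P h'
  rw [inner_neg_left] at this
  linarith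

theorem map_eq_self_of_mem_parabolic {J : Set (Fin n)} {v : Space n}
    (hv : ∀ i ∈ J, ⟪simpleRoot i, v⟫ = 0) {b : Isom n} (hb : b ∈ parabolic J) : b v = v := by
  refine parabolic_induction (p := fun b => b v = v) rfl (fun b _ i hi _ h => ?_) hb
  change b (refl (simpleRoot i) v) = v
  rw [refl_of_inner_eq_zero (hv i hi), h]

theorem map_lam {P : Set (Fin n)} {b : Isom n} (hb : b ∈ parabolic P) : b (lam P) = lam P :=
  map_eq_self_of_mem_parabolic (fun _ hi => inner_simpleRoot_lam_of_mem hi) hb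

/-- If `b * s_i` fixes `lam P` and `b` sends the `i`-th simple root to a positive root, then
`⟪simpleRoot i, lam P⟫` is both nonnegative and nonpositive, which forces `i ∈ P`; induct. -/
theorem mem_parabolic_of_map_lam {P : Set (Fin n)} {w : Isom n} (hw : w ∈ weyl n)
    (h : w (lam P) = lam P) : w ∈ parabolic P := by
  refine parabolic_induction (p := fun b => b (lam P) = lam P → b ∈ parabolic P)
    (fun _ => one_mem _) (fun b _ i _ hpos ih h => ?_) hw h
  change b (refl (simpleRoot i) (lam P)) = lam P at h
  have h₁ : ⟪simpleRoot i, lam P⟫ = -⟪b (simpleRoot i), lam P⟫ := by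
    conv_rhs => rw [← h]
    rw [inner_map, ← inner_refl_left, refl_self, inner_neg_left, neg_neg]
  have h₂ := inner_lam_nonneg P hpos
  have hi : i ∈ P := by
    by_contra hi
    have := inner_simpleRoot_lam_pos hi
    linarith
  rw [refl_of_inner_eq_zero (inner_simpleRoot_lam_of_mem hi)] at h
  exact mul_mem (ih h) (refl_mem_parabolic hi)

/-- `W_J` fixes the coweights outside `J`, so the positive root `b (simpleRoot i)` is a nonnegative
combination of simple roots from `J` alone. -/
theorem inner_map_simpleRoot_nonneg {J : Set (Fin n)} {v : Space n}
    (hv : ∀ i ∈ J, 0 ≤ ⟪simpleRoot i, v⟫) {b : Isom n} (hb : b ∈ parabolic J) {i : Fin n}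
    (hi : i ∈ J) (hpos : b (simpleRoot i) ∈ posRoots n) : 0 ≤ ⟪b (simpleRoot i), v⟫ := by
  have h₀ : ∀ k ∉ J, ⟪b (simpleRoot i), coweight k⟫ = 0 := by
    intro k hk
    rw [inner_map_left, map_eq_self_of_mem_parabolic (J := J) _ (inv_mem hb)]
    · exact inner_simpleRoot_coweight_of_ne fun h => hk (h ▸ hi)
    · exact fun j hj => inner_simpleRoot_coweight_of_ne fun h => hk (h ▸ hj)
  obtain ⟨-, c, hc⟩ := hpos
  rw [hc, sum_inner]
  refine Finset.sum_nonneg fun k _ => ?_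
  rw [real_inner_smul_left]
  by_cases hk : k ∈ J
  · exact mul_nonneg (Nat.cast_nonneg _) (hv k hk)
  · have := h₀ k hk
    rw [hc, inner_sum_simpleRoot_coweight] at this
    rw [(mul_eq_zero.1 this).resolve_right (inner_simpleRoot_coweight_pos k).ne', zero_mul]

/-- Each length-increasing step subtracts from `b v` a nonnegative multiple of `b (simpleRoot i)`,
which pairs nonnegatively with `v'`. -/
theorem inner_map_le {J : Set (Fin n)} {v v' : Space n} (hv : ∀ i ∈ J, 0 ≤ ⟪simpleRoot i, v⟫)
    (hv' : ∀ i ∈ J, 0 ≤ ⟪simpleRoot i, v'⟫) {b : Isom n} (hb : b ∈ parabolic J) :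
    ⟪b v, v'⟫ ≤ ⟪v, v'⟫ := by
  refine parabolic_induction (p := fun b => ⟪b v, v'⟫ ≤ ⟪v, v'⟫) le_rfl
    (fun b hb i hi hpos ih => ?_) hb
  refine le_trans ?_ ih
  change ⟪b (refl (simpleRoot i) v), v'⟫ ≤ _
  rw [refl_apply, map_sub, map_smul, inner_sub_left, real_inner_smul_left]
  have h₁ := inner_map_simpleRoot_nonneg hv' hb hi hpos
  have h₂ : 0 ≤ 2 * ⟪simpleRoot i, v⟫ / ⟪simpleRoot i, simpleRoot i⟫ :=
    div_nonneg (mul_nonneg zero_le_two (hv i hi)) real_inner_self_nonneg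
  have := mul_nonneg h₂ h₁
  linarith

/-- A `W_J`-orbit has at most one `J`-dominant vector: `inner_map_le` with `v' = b v` gives `⟪v, v⟫
≤ ⟪v, b v⟫`, hence `‖b v - v‖² ≤ 0`. Uniqueness of both kinds of minimal representatives rests on
this. -/
theorem map_eq_self_of_dominant {J : Set (Fin n)} {v : Space n} {b : Isom n}
    (hb : b ∈ parabolic J) (hv : ∀ i ∈ J, 0 ≤ ⟪simpleRoot i, v⟫)
    (hbv : ∀ i ∈ J, 0 ≤ ⟪simpleRoot i, b v⟫) : b v = v := by
  have h₁ := inner_map_le hv hbv hb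
  have h₂ : ⟪b v - v, b v - v⟫ ≤ 0 := by
    have h₃ := real_inner_comm (b v) v
    rw [inner_map] at h₁
    rw [inner_sub_sub_self, inner_map]
    linarith
  exact sub_eq_zero.1 (inner_self_eq_zero.1 (le_antisymm h₂ real_inner_self_nonneg))

theorem eq_one_of_map_lam_empty {w : Isom n} (hw : w ∈ weyl n) (h : w (lam ∅) = lam ∅) :
    w = 1 := by
  have := mem_parabolic_of_map_lam hw h
  simpa [parabolic] using this

theorem map_simpleRoot_mem_posRoots {P : Set (Fin n)} {x : Isom n} (hx : x ∈ minLeft P)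
    {i : Fin n} (hi : i ∈ P) : x (simpleRoot i) ∈ posRoots n := by
  refine (mem_posRoots_or_neg_mem (map_mem_roots hx.1 (simpleRoot_mem_roots i))).resolve_right
    fun h => ?_
  have h₁ := length_mul_refl_lt hx.1 (simpleRoot_mem_posRoots i) h
  exact absurd (hx.2 _ ⟨_, refl_mem_parabolic hi, rfl⟩) (not_le.2 h₁)

/-- Minimality of `x` makes `x⁻¹ (lam ∅)` a `P`-dominant vector. Two minimal elements of one coset
give two such vectors in one `W_P`-orbit, and `lam ∅` has trivial stabilizer. -/
theorem minLeft_unique {P : Set (Fin n)} {x x' : Isom n} (hx : x ∈ minLeft P)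
    (hx' : x' ∈ minLeft P) (h : x' ∈ leftCoset P x) : x' = x := by
  obtain ⟨b, hb, rfl⟩ := h
  have hdom : ∀ y ∈ minLeft P, ∀ i ∈ P, 0 ≤ ⟪simpleRoot i, y⁻¹ (lam ∅)⟫ := by
    intro y hy i hi
    rw [← inner_map_left]
    exact inner_lam_nonneg ∅ (map_simpleRoot_mem_posRoots hy hi)
  have h₁ : (x * b)⁻¹ (lam ∅) = b⁻¹ (x⁻¹ (lam ∅)) := by
    rw [mul_inv_rev]
    rfl
  have h₂ := map_eq_self_of_dominant (inv_mem hb) (hdom x hx) (by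
    rw [← h₁]
    exact hdom _ hx')
  rw [← h₁, inv_apply_eq] at h₂
  have h₃ := eq_one_of_map_lam_empty (mul_mem hx'.1 (inv_mem hx.1)) h₂.symm
  exact mul_inv_eq_one.1 h₃

theorem leftCoset_eq {P : Set (Fin n)} {w w' : Isom n} (h : w' ∈ leftCoset P w) :
    leftCoset P w' = leftCoset P w := by
  obtain ⟨b, hb, rfl⟩ := h
  ext x
  constructor
  · rintro ⟨c, hc, rfl⟩
    exact ⟨b * c, mul_mem hb hc, mul_assoc _ _ _⟩
  · rintro ⟨c, hc, rfl⟩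
    exact ⟨b⁻¹ * c, mul_mem (inv_mem hb) hc, by group⟩

theorem doubleCoset_eq {Q P : Set (Fin n)} {w w' : Isom n} (h : w' ∈ doubleCoset Q P w) :
    doubleCoset Q P w' = doubleCoset Q P w := by
  obtain ⟨a, ha, b, hb, rfl⟩ := h
  ext x
  constructor
  · rintro ⟨c, hc, d, hd, rfl⟩
    exact ⟨c * a, mul_mem hc ha, b * d, mul_mem hb hd, by group⟩
  · rintro ⟨c, hc, d, hd, rfl⟩
    exact ⟨c * a⁻¹, mul_mem hc (inv_mem ha), b⁻¹ * d, mul_mem (inv_mem hb) hd, by group⟩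

theorem mem_weyl_of_mem_doubleCoset {Q P : Set (Fin n)} {w w' : Isom n} (hw : w ∈ weyl n)
    (h : w' ∈ doubleCoset Q P w) : w' ∈ weyl n := by
  obtain ⟨a, ha, b, hb, rfl⟩ := h
  exact mul_mem (mul_mem (parabolic_le_weyl _ ha) hw) (parabolic_le_weyl _ hb)

theorem leftCoset_subset_doubleCoset (Q P : Set (Fin n)) (w : Isom n) :
    leftCoset P w ⊆ doubleCoset Q P w := by
  rintro x ⟨b, hb, rfl⟩
  exact ⟨1, one_mem _, b, hb, by group⟩

theorem bar_mem (P : Set (Fin n)) (w : Isom n) : bar P w ∈ leftCoset P w :=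
  Function.argminOn_mem _ _ _

theorem hat_mem (Q P : Set (Fin n)) (w : Isom n) : hat Q P w ∈ doubleCoset Q P w :=
  Function.argminOn_mem _ _ _

theorem bar_congr {P : Set (Fin n)} {w w' : Isom n} (h : w' ∈ leftCoset P w) :
    bar P w' = bar P w := by
  have := leftCoset_eq h
  unfold bar
  congr 1

theorem hat_congr {Q P : Set (Fin n)} {w w' : Isom n} (h : w' ∈ doubleCoset Q P w) :
    hat Q P w' = hat Q P w := by
  have := doubleCoset_eq h
  unfold hat
  congr 1

theorem hat_mem_minDouble {Q P : Set (Fin n)} {w : Isom n} (hw : w ∈ weyl n) :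
    hat Q P w ∈ minDouble Q P := by
  refine ⟨mem_weyl_of_mem_doubleCoset hw (hat_mem Q P w), fun x hx => ?_⟩
  rw [doubleCoset_eq (hat_mem Q P w)] at hx
  exact Function.argminOn_le _ _ hx

theorem bar_mem_minLeft {P : Set (Fin n)} {w : Isom n} (hw : w ∈ weyl n) :
    bar P w ∈ minLeft P := by
  refine ⟨mem_weyl_of_mem_doubleCoset hw (leftCoset_subset_doubleCoset P P w (bar_mem P w)),
    fun x hx => ?_⟩
  rw [leftCoset_eq (bar_mem P w)] at hx
  exact Function.argminOn_le _ _ hx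

theorem minDouble_subset_minLeft (Q P : Set (Fin n)) : minDouble Q P ⊆ minLeft P :=
  fun _ hw => ⟨hw.1, fun x hx => hw.2 x (leftCoset_subset_doubleCoset Q P _ hx)⟩

theorem bar_eq_self {P : Set (Fin n)} {w : Isom n} (hw : w ∈ minLeft P) : bar P w = w :=
  minLeft_unique hw (bar_mem_minLeft hw.1) (bar_mem P w)

theorem mem_leftCoset_iff {P : Set (Fin n)} {w w' : Isom n} (hw : w ∈ weyl n)
    (hw' : w' ∈ weyl n) : w' ∈ leftCoset P w ↔ w' (lam P) = w (lam P) := by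
  constructor
  · rintro ⟨b, hb, rfl⟩
    change w (b (lam P)) = _
    rw [map_lam hb]
  · intro h
    refine ⟨w⁻¹ * w', mem_parabolic_of_map_lam (mul_mem (inv_mem hw) hw') ?_, by group⟩
    exact inv_apply_eq.2 h

theorem bar_eq_bar_iff {P : Set (Fin n)} {w w' : Isom n} (hw : w ∈ weyl n) (hw' : w' ∈ weyl n) :
    bar P w' = bar P w ↔ w' (lam P) = w (lam P) := by
  rw [← mem_leftCoset_iff hw hw']
  refine ⟨fun h => ?_, bar_congr⟩
  have h₁ := leftCoset_eq (bar_mem P w')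
  rw [h, leftCoset_eq (bar_mem P w)] at h₁
  rw [h₁]
  exact ⟨1, one_mem _, by group⟩

theorem bar_lam {P : Set (Fin n)} {w : Isom n} (hw : w ∈ weyl n) :
    bar P w (lam P) = w (lam P) :=
  (mem_leftCoset_iff hw (bar_mem_minLeft hw).1).1 (bar_mem P w)

theorem mem_doubleCoset_iff {Q P : Set (Fin n)} {w w' : Isom n} (hw : w ∈ weyl n)
    (hw' : w' ∈ weyl n) :
    w' ∈ doubleCoset Q P w ↔ ∃ a ∈ parabolic Q, w' (lam P) = a (w (lam P)) := by
  constructor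
  · rintro ⟨a, ha, b, hb, rfl⟩
    refine ⟨a, ha, ?_⟩
    change a (w (b (lam P))) = _
    rw [map_lam hb]
  · rintro ⟨a, ha, h⟩
    obtain ⟨b, hb, rfl⟩ := (mem_leftCoset_iff (mul_mem (parabolic_le_weyl _ ha) hw) hw').2 h
    exact ⟨a, ha, b, hb, rfl⟩

theorem inner_simpleRoot_minDouble_nonneg {Q P : Set (Fin n)} {u : Isom n}
    (hu : u ∈ minDouble Q P) {i : Fin n} (hi : i ∈ Q) : 0 ≤ ⟪simpleRoot i, u (lam P)⟫ := by
  rw [inner_map_right]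
  refine inner_lam_nonneg P ((mem_posRoots_or_neg_mem
    (map_mem_roots (inv_mem hu.1) (simpleRoot_mem_roots i))).resolve_right fun h => ?_)
  have h₁ := length_refl_mul_lt hu.1 (simpleRoot_mem_posRoots i) h
  exact absurd (hu.2 _ ⟨_, refl_mem_parabolic hi, 1, one_mem _, by group⟩) (not_le.2 h₁)

theorem minDouble_unique {Q P : Set (Fin n)} {u u' : Isom n} (hu : u ∈ minDouble Q P)
    (hu' : u' ∈ minDouble Q P) (h : u' ∈ doubleCoset Q P u) : u' = u := by
  obtain ⟨a, ha, h⟩ := (mem_doubleCoset_iff hu.1 hu'.1).1 h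
  have h₁ := map_eq_self_of_dominant ha (fun i hi => inner_simpleRoot_minDouble_nonneg hu hi)
    (fun i hi => by
      rw [← h]
      exact inner_simpleRoot_minDouble_nonneg hu' hi)
  exact minLeft_unique (minDouble_subset_minLeft Q P hu) (minDouble_subset_minLeft Q P hu')
    ((mem_leftCoset_iff hu.1 hu'.1).2 (h.trans h₁))

theorem hat_eq_self {Q P : Set (Fin n)} {u : Isom n} (hu : u ∈ minDouble Q P) :
    hat Q P u = u :=
  minDouble_unique hu (hat_mem_minDouble hu.1) (hat_mem Q P u)

theorem hat_eq_hat_iff {Q P : Set (Fin n)} {w w' : Isom n} (hw : w ∈ weyl n)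
    (hw' : w' ∈ weyl n) :
    hat Q P w' = hat Q P w ↔ ∃ a ∈ parabolic Q, w' (lam P) = a (w (lam P)) := by
  rw [← mem_doubleCoset_iff hw hw']
  refine ⟨fun h => ?_, hat_congr⟩
  have h₁ := doubleCoset_eq (hat_mem Q P w')
  rw [h, doubleCoset_eq (hat_mem Q P w)] at h₁
  rw [h₁]
  exact ⟨1, one_mem _, 1, one_mem _, by group⟩

theorem exists_map_hat_lam (Q : Set (Fin n)) {P : Set (Fin n)} {w : Isom n} (hw : w ∈ weyl n) :
    ∃ a ∈ parabolic Q, a (hat Q P w (lam P)) = w (lam P) := by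
  obtain ⟨a, ha, h⟩ := (mem_doubleCoset_iff hw (hat_mem_minDouble hw).1).1 (hat_mem Q P w)
  exact ⟨a⁻¹, inv_mem ha, by rw [h, inv_apply_self]⟩

end Dominant

/-! ### Closedness in terms of reflections -/

section Closedness

variable {n : ℕ}

/-- Up to sign, the roots whose reflections move `y` into a given orbit of the stabilizer of `x`,
different from the orbit of `y`, are permuted transitively by the common stabilizer
of `x` and `y`. -/
def SingleOrbit (x y : Space n) : Prop :=
  ∀ α ∈ roots n, ∀ α' ∈ roots n, ⟪α, x⟫ ≠ 0 → ⟪α, y⟫ ≠ 0 →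
    (∃ w ∈ weyl n, w x = x ∧ w (refl α y) = refl α' y) →
    ∃ w ∈ weyl n, w x = x ∧ w y = y ∧ (w α = α' ∨ w α = -α')

theorem inner_refl_right (x α y : Space n) :
    ⟪x, refl α y⟫ = ⟪x, y⟫ - 2 * (⟪α, x⟫ * ⟪α, y⟫) / ⟪α, α⟫ := by
  rw [refl_apply, inner_sub_right, real_inner_smul_right, real_inner_comm α x]
  ring

theorem inner_self_root_pos {α : Space n} (hα : α ∈ roots n) : 0 < ⟪α, α⟫ := by
  rcases inner_self_root hα with h | h <;> rw [h] <;> norm_num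

/-- The pairing with `x` is constant on orbits of the stabilizer of `x`. So this detects that a
reflection in a root orthogonal to neither `x` nor `y` moves `y` out of its orbit. -/
theorem inner_mul_inner_eq_of_inner_refl_eq {x y α : Space n} (hα : α ∈ roots n)
    (h : ⟪x, refl α y⟫ = ⟪x, y⟫) : ⟪α, x⟫ * ⟪α, y⟫ = 0 := by
  rw [inner_refl_right, sub_eq_self, div_eq_zero_iff] at h
  have := (inner_self_root_pos hα).ne'
  exact ((mul_eq_zero.1 (h.resolve_right this)).resolve_left two_ne_zero)

theorem inner_map_right_of_fixed {w : Isom n} {x : Space n} (h : w x = x) (y : Space n) :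
    ⟪x, w y⟫ = ⟪x, y⟫ := by
  conv_lhs => rw [← h]
  exact inner_map w x y

theorem inner_map_left_of_fixed {w : Isom n} {x : Space n} (h : w x = x) (y : Space n) :
    ⟪w y, x⟫ = ⟪y, x⟫ := by
  conv_lhs => rw [← h]
  exact inner_map w y x

theorem inner_ne_zero_of_orbit {x y α α' : Space n} (hα : α ∈ roots n)
    (hx : ⟪α, x⟫ ≠ 0) (hy : ⟪α, y⟫ ≠ 0)
    (h : ∃ w : Isom n, w x = x ∧ w (refl α y) = refl α' y) :
    ⟪α', x⟫ ≠ 0 ∧ ⟪α', y⟫ ≠ 0 := by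
  obtain ⟨w, hw, h⟩ := h
  by_contra hc
  have h₁ : ⟪α', x⟫ * ⟪α', y⟫ = 0 := by
    rw [mul_eq_zero]
    tauto
  have h₂ := inner_map_right_of_fixed hw (refl α y)
  rw [h, inner_refl_right x α' y, h₁, mul_zero, zero_div, sub_zero] at h₂
  exact mul_ne_zero hx hy (inner_mul_inner_eq_of_inner_refl_eq hα h₂.symm)

theorem mul_apply (g h : Isom n) (v : Space n) : (g * h) v = g (h v) := rfl

theorem refl_mul_apply_lam (α : Space n) (w : Isom n) (P : Set (Fin n)) :
    (refl α * w) (lam P) = refl α (w (lam P)) := rfl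

theorem refl_mem_parabolic_of_inner {Q : Set (Fin n)} {α : Space n} (hα : α ∈ roots n)
    (h : ⟪α, lam Q⟫ = 0) : refl α ∈ parabolic Q :=
  mem_parabolic_of_map_lam (refl_mem_weyl hα) (refl_of_inner_eq_zero h)

/-- Here `w` is any representative of its coset, so edges can be translated by `W_Q` without passing
to minimal representatives. -/
theorem mem_edges_parabolicGraph {P : Set (Fin n)} {t : Isom n × Space n × Isom n} :
    t ∈ (parabolicGraph P).edges ↔ ∃ w ∈ weyl n, ∃ α ∈ posRoots n, 0 < ⟪α, w (lam P)⟫ ∧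
      t = (bar P w, α, bar P (refl α * w)) := by
  constructor
  · rintro ⟨w, hw, α, hα, hle, hne, rfl⟩
    refine ⟨w, hw.1, α, hα, lt_of_le_of_ne ?_ fun h => hne ?_, by rw [bar_eq_self hw]⟩
    · rw [inner_map_right]
      exact inner_lam_nonneg P ((bruhatLE_refl_mul_iff hw.1 hα).1 hle)
    · rw [bar_eq_bar_iff (refl_mul_mem_weyl hα.1 hw.1) hw.1, refl_mul_apply_lam,
        refl_of_inner_eq_zero h.symm]
  · rintro ⟨w, hw, α, hα, hpos, rfl⟩
    have hb := bar_mem_minLeft (P := P) hw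
    rw [← bar_lam hw] at hpos
    have h₁ : bar P (refl α * w) = bar P (refl α * bar P w) := by
      rw [bar_eq_bar_iff (refl_mul_mem_weyl hα.1 hb.1) (refl_mul_mem_weyl hα.1 hw),
        refl_mul_apply_lam, refl_mul_apply_lam, bar_lam hw]
    refine ⟨bar P w, hb, α, hα, (bruhatLE_refl_mul_iff hb.1 hα).2 ?_, fun h => ?_, by rw [h₁]⟩
    · rw [inner_map_right] at hpos
      exact mem_posRoots_of_inner_lam_pos P (map_mem_roots (inv_mem hb.1) hα.1) hpos
    · rw [bar_eq_bar_iff (refl_mul_mem_weyl hα.1 hb.1) hb.1, refl_mul_apply_lam] at h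
      exact hpos.ne' (refl_eq_self_iff.1 h.symm)

theorem mem_doubleEdges {Q P : Set (Fin n)} {u : Isom n} (hu : u ∈ minDouble Q P) {β : Space n}
    (hβ : β ∈ posRoots n) (h : 0 < ⟪β, u (lam P)⟫) (hQ : ⟪β, lam Q⟫ ≠ 0) :
    (u, hat Q P (refl β * u)) ∈ doubleEdges Q P := by
  refine ⟨hu, fun heq => ?_, β, hβ, rfl, (bruhatLE_refl_mul_iff hu.1 hβ).2 ?_⟩
  · have h₁ : hat Q P (refl β * u) = hat Q P u := by
      rw [hat_eq_self hu]
      exact heq.symm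
    obtain ⟨a, ha, h₂⟩ := (hat_eq_hat_iff hu.1 (refl_mul_mem_weyl hβ.1 hu.1)).1 h₁
    have h₃ := inner_map_right_of_fixed (map_lam ha) (u (lam P))
    rw [← h₂] at h₃
    exact mul_ne_zero hQ h.ne' (inner_mul_inner_eq_of_inner_refl_eq hβ.1 h₃)
  · rw [inner_map_right] at h
    exact mem_posRoots_of_inner_lam_pos P (map_mem_roots (inv_mem hu.1) hβ.1) h

namespace DoubleMomentGraph

variable {Q P : Set (Fin n)} (D : DoubleMomentGraph Q P)

theorem fst_mem (t : doubleEdges Q P) : t.1.1 ∈ minDouble Q P := t.2.1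

theorem label_mem_posRoots (t : doubleEdges Q P) : D.label t ∈ posRoots n :=
  (D.isPossibleLabel_label t).1

theorem snd_eq (t : doubleEdges Q P) : t.1.2 = hat Q P (refl (D.label t) * t.1.1) :=
  (D.isPossibleLabel_label t).2.1

theorem inner_label_lam_fst_pos (t : doubleEdges Q P) : 0 < ⟪D.label t, t.1.1 (lam P)⟫ := by
  obtain ⟨hpos, heq, hle⟩ := D.isPossibleLabel_label t
  have hu := fst_mem t
  refine lt_of_le_of_ne ?_ fun h => t.2.2.1 ?_
  · rw [inner_map_right]
    exact inner_lam_nonneg P ((bruhatLE_refl_mul_iff hu.1 hpos).1 hle)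
  · conv_lhs => rw [← hat_eq_self hu]
    rw [heq]
    refine (hat_eq_hat_iff (refl_mul_mem_weyl hpos.1 hu.1) hu.1).2 ⟨1, one_mem _, ?_⟩
    rw [refl_mul_apply_lam, refl_of_inner_eq_zero h.symm]
    rfl

/-- A label orthogonal to `lam Q` has its reflection in `W_Q`, and the edge would be a loop. -/
theorem inner_label_lam_pos (t : doubleEdges Q P) : 0 < ⟪D.label t, lam Q⟫ := by
  obtain ⟨hpos, heq, hle⟩ := D.isPossibleLabel_label t
  have hu := fst_mem t
  refine lt_of_le_of_ne (inner_lam_nonneg Q hpos) fun h => t.2.2.1 ?_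
  conv_lhs => rw [← hat_eq_self hu]
  rw [heq]
  refine (hat_eq_hat_iff (refl_mul_mem_weyl hpos.1 hu.1) hu.1).2
    ⟨_, refl_mem_parabolic_of_inner hpos.1 h.symm, ?_⟩
  exact (refl_refl_apply _ _).symm

theorem verts_closure : (closureGraph Q P D.toParabolic).verts = minLeft P := by
  ext y
  constructor
  · rintro ⟨w, hw, x, hx, rfl⟩
    refine bar_mem_minLeft (mul_mem (parabolic_le_weyl _ hw) ?_)
    rcases hx with hx | ⟨t, rfl⟩
    · exact hx.1
    · exact (bar_mem_minLeft (refl_mul_mem_weyl (D.label_mem_posRoots t).1 (fst_mem t).1)).1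
  · intro hy
    obtain ⟨a, ha, h⟩ := exists_map_hat_lam Q (P := P) hy.1
    have hu := hat_mem_minDouble (Q := Q) (P := P) hy.1
    refine ⟨a, ha, _, Or.inl hu, ?_⟩
    conv_lhs => rw [← bar_eq_self hy]
    exact (bar_eq_bar_iff (mul_mem (parabolic_le_weyl _ ha) hu.1) hy.1).2 h.symm

theorem edges_closure_subset :
    (closureGraph Q P D.toParabolic).edges ⊆ (parabolicGraph P).edges := by
  rintro s ((⟨hs, -⟩ | ⟨x, α, y, ⟨t, ht⟩, w, hw, hpos, rfl⟩) | ⟨x, α, y, ⟨t, ht⟩, w, hw, hpos, rfl⟩)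
  · exact hs
  · obtain ⟨rfl, rfl, rfl⟩ : x = t.1.1 ∧ α = D.label t ∧
        y = bar P (refl (D.label t) * t.1.1) := by simpa using ht
    have hW := parabolic_le_weyl _ hw
    have hu := (fst_mem t).1
    have hr := refl_mul_mem_weyl (D.label_mem_posRoots t).1 hu
    refine mem_edges_parabolicGraph.2 ⟨w * t.1.1, mul_mem hW hu, w (D.label t), hpos, ?_, ?_⟩
    · rw [mul_apply, inner_map]
      exact D.inner_label_lam_fst_pos t
    · congr 2
      rw [bar_eq_bar_iff (refl_mul_mem_weyl hpos.1 (mul_mem hW hu))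
        (mul_mem hW (bar_mem_minLeft hr).1)]
      rw [mul_apply, bar_lam hr, mul_apply, mul_apply, mul_apply, ← map_refl]
  · obtain ⟨rfl, rfl, rfl⟩ : x = t.1.1 ∧ α = D.label t ∧
        y = bar P (refl (D.label t) * t.1.1) := by simpa using ht
    -- No reversed translate exists: `w` fixes `lam Q`, so `w (D.label t)` still pairs positively
    -- with it and stays positive.
    have h₁ := inner_lam_nonneg Q hpos
    rw [inner_neg_left, inner_map_left_of_fixed (map_lam hw)] at h₁
    have := D.inner_label_lam_pos t
    linarith

/-- An edge with label orthogonal to `lam Q` stays in one `W_Q`-orbit. Any other is translated by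
`b⁻¹` to start at the double representative `u`, and the single orbit condition then carries the
chosen label to the translated one. -/
theorem isClosed_of_singleOrbit (h : ∀ u ∈ weyl n, SingleOrbit (lam Q) (u (lam P))) :
    D.IsClosed := by
  refine MomentGraph.ext D.verts_closure (subset_antisymm D.edges_closure_subset ?_)
  intro s hs
  obtain ⟨w, hw, α, hα, hpos, rfl⟩ := mem_edges_parabolicGraph.1 hs
  have hsw := refl_mul_mem_weyl hα.1 hw
  have hu := hat_mem_minDouble (Q := Q) (P := P) hw
  obtain ⟨b, ha, hau⟩ := exists_map_hat_lam Q (P := P) hw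
  set u := hat Q P w
  have hbW := parabolic_le_weyl _ ha
  by_cases hQ : ⟪α, lam Q⟫ = 0
  · have hr := refl_mem_parabolic_of_inner hα.1 hQ
    refine Or.inl (Or.inl ⟨hs, u, Or.inl hu, b, ha, refl α * b, mul_mem hr ha, ?_, ?_⟩)
    · exact (bar_eq_bar_iff (mul_mem hbW hu.1) hw).2 hau.symm
    · refine (bar_eq_bar_iff (mul_mem (parabolic_le_weyl _ (mul_mem hr ha)) hu.1) hsw).2 ?_
      exact congrArg (refl α) hau.symm
  · have hQ' := lt_of_le_of_ne (inner_lam_nonneg Q hα) (Ne.symm hQ)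
    set γ := b⁻¹ α with hγ
    have hbγ : b γ = α := apply_inv_self b α
    have hγQ : 0 < ⟪γ, lam Q⟫ := by
      rw [hγ, inner_map_left_of_fixed (map_lam (inv_mem ha))]
      exact hQ'
    have hγr : γ ∈ roots n := map_mem_roots (inv_mem hbW) hα.1
    have hγpos := mem_posRoots_of_inner_lam_pos Q hγr hγQ
    have hγu : 0 < ⟪γ, u (lam P)⟫ := by
      rw [← inner_map b, hbγ, hau]
      exact hpos
    let t : doubleEdges Q P := ⟨_, mem_doubleEdges hu hγpos hγu hγQ.ne'⟩
    have hβ := D.label_mem_posRoots t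
    have h₁ : hat Q P (refl γ * u) = hat Q P (refl (D.label t) * u) := D.snd_eq t
    obtain ⟨c, hc, h₂⟩ := (hat_eq_hat_iff (refl_mul_mem_weyl hβ.1 hu.1)
      (refl_mul_mem_weyl hγr hu.1)).1 h₁
    obtain ⟨v, hv, hvQ, hvu, hvβ⟩ := h u hu.1 (D.label t) hβ.1 γ hγr
      (D.inner_label_lam_pos t).ne' (D.inner_label_lam_fst_pos t).ne'
      ⟨c, parabolic_le_weyl _ hc, map_lam hc, h₂.symm⟩
    have hvγ : v (D.label t) = γ := by
      refine hvβ.resolve_right fun h' => ?_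
      have h₃ := inner_map_left_of_fixed hvQ (D.label t)
      rw [h', inner_neg_left] at h₃
      have := D.inner_label_lam_pos t
      linarith
    have hvP := mem_parabolic_of_map_lam hv hvQ
    have hb₁ : bar P w = bar P (b * v * u) := by
      refine (bar_eq_bar_iff (mul_mem (mul_mem hbW hv) hu.1) hw).2 ?_
      rw [mul_apply, mul_apply, hvu, hau]
    have hb₂ : α = (b * v) (D.label t) := by
      change _ = b (v (D.label t))
      rw [hvγ, hbγ]
    refine Or.inl (Or.inr ⟨u, D.label t, _, ⟨t, rfl⟩, b * v, mul_mem ha hvP, ?_, ?_⟩)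
    · rwa [← hb₂]
    · rw [← hb₂, hb₁]
      congr 2
      have hr := refl_mul_mem_weyl hβ.1 hu.1
      refine (bar_eq_bar_iff (mul_mem (mul_mem hbW hv) (bar_mem_minLeft hr).1) hsw).2 ?_
      rw [mul_apply, mul_apply, mul_apply, bar_lam hr, mul_apply, map_refl v, hvγ, hvu, map_refl b, hbγ, hau]

theorem exists_translate_of_isClosed (h : D.IsClosed) {w : Isom n} (hw : w ∈ weyl n)
    {α : Space n} (hα : α ∈ roots n) (hQ : 0 < ⟪α, lam Q⟫) (hP : 0 < ⟪α, w (lam P)⟫) :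
    ∃ t : doubleEdges Q P, ∃ a ∈ parabolic Q,
      a (t.1.1 (lam P)) = w (lam P) ∧ a (D.label t) = α := by
  have hpos := mem_posRoots_of_inner_lam_pos Q hα hQ
  have hs := mem_edges_parabolicGraph.2 ⟨w, hw, α, hpos, hP, rfl⟩
  rw [← h] at hs
  have hsw := refl_mul_mem_weyl hα hw
  rcases hs with (⟨-, x, hx, a, ha, b, hb, h₁, h₂⟩ | ⟨x, γ, y, ⟨t, ht⟩, a, ha, -, heq⟩) |
    ⟨x, γ, y, ⟨t, ht⟩, a, ha, -, heq⟩
  -- Both ends would lie in one `W_Q`-orbit, which the pairing with `lam Q` forbids.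
  · exfalso
    have hx' : x ∈ weyl n := by
      rcases hx with hx | ⟨t, rfl⟩
      · exact hx.1
      · exact (bar_mem_minLeft (refl_mul_mem_weyl (D.label_mem_posRoots t).1 (fst_mem t).1)).1
    have h₃ := (bar_eq_bar_iff (mul_mem (parabolic_le_weyl _ ha) hx') hw).1 h₁
    have h₄ := (bar_eq_bar_iff (mul_mem (parabolic_le_weyl _ hb) hx') hsw).1 h₂
    rw [mul_apply] at h₃
    rw [mul_apply, mul_apply] at h₄
    refine mul_ne_zero hQ.ne' hP.ne' (inner_mul_inner_eq_of_inner_refl_eq hα ?_)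
    rw [h₄, inner_map_right_of_fixed (map_lam hb), h₃, inner_map_right_of_fixed (map_lam ha)]
  · obtain ⟨rfl, rfl, rfl⟩ : x = t.1.1 ∧ γ = D.label t ∧
        y = bar P (refl (D.label t) * t.1.1) := by simpa using ht
    simp only [Prod.mk.injEq] at heq
    exact ⟨t, a, ha, ((bar_eq_bar_iff (mul_mem (parabolic_le_weyl _ ha) (fst_mem t).1) hw).1
      heq.1).symm, heq.2.1.symm⟩
  · exfalso
    obtain ⟨rfl, rfl, rfl⟩ : x = t.1.1 ∧ γ = D.label t ∧
        y = bar P (refl (D.label t) * t.1.1) := by simpa using ht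
    simp only [Prod.mk.injEq] at heq
    rw [heq.2.1, inner_neg_left, inner_map_left_of_fixed (map_lam ha)] at hQ
    have := D.inner_label_lam_pos t
    linarith

/-- Both edges are translates of chosen edges joining the same pair of double cosets; only one label
is chosen for that pair, so they are translates of one another. -/
theorem exists_map_of_isClosed (h : D.IsClosed) {w w' : Isom n} (hw : w ∈ weyl n)
    (hw' : w' ∈ weyl n) {α α' : Space n} (hα : α ∈ roots n) (hα' : α' ∈ roots n)
    (hQ : 0 < ⟪α, lam Q⟫) (hP : 0 < ⟪α, w (lam P)⟫) (hQ' : 0 < ⟪α', lam Q⟫)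
    (hP' : 0 < ⟪α', w' (lam P)⟫)
    (h₁ : ∃ c ∈ parabolic Q, w' (lam P) = c (w (lam P)))
    (h₂ : ∃ c ∈ parabolic Q, refl α' (w' (lam P)) = c (refl α (w (lam P)))) :
    ∃ v ∈ parabolic Q, v (w (lam P)) = w' (lam P) ∧ v α = α' := by
  obtain ⟨t, a, ha, hat, haα⟩ := D.exists_translate_of_isClosed h hw hα hQ hP
  obtain ⟨t', a', ha', hat', haα'⟩ := D.exists_translate_of_isClosed h hw' hα' hQ' hP'
  obtain ⟨c, hc, h₁⟩ := h₁
  obtain ⟨d, hd, h₂⟩ := h₂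
  have ht₁ : t'.1.1 = t.1.1 := by
    rw [← hat_eq_self (fst_mem t), ← hat_eq_self (fst_mem t'),
      hat_eq_hat_iff (fst_mem t).1 (fst_mem t').1]
    refine ⟨a'⁻¹ * (c * a), mul_mem (inv_mem ha') (mul_mem hc ha), ?_⟩
    rw [mul_apply, mul_apply, hat, ← h₁, ← hat', inv_apply_self]
  have ht₂ : t'.1.2 = t.1.2 := by
    rw [D.snd_eq t, D.snd_eq t',
      hat_eq_hat_iff (refl_mul_mem_weyl (D.label_mem_posRoots t).1 (fst_mem t).1)
        (refl_mul_mem_weyl (D.label_mem_posRoots t').1 (fst_mem t').1)]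
    refine ⟨a'⁻¹ * (d * a), mul_mem (inv_mem ha') (mul_mem hd ha), ?_⟩
    rw [mul_apply, mul_apply, mul_apply, mul_apply, map_refl a, hat, haα, ← h₂, ← hat', ← haα',
      ← map_refl, inv_apply_self]
  obtain rfl : t' = t := Subtype.ext (Prod.ext ht₁ ht₂)
  refine ⟨a' * a⁻¹, mul_mem ha' (inv_mem ha), ?_, ?_⟩
  · rw [mul_apply, ← hat, inv_apply_self, hat']
  · rw [mul_apply, ← haα, inv_apply_self, haα']

theorem singleOrbit_of_isClosed (h : D.IsClosed) {u : Isom n} (hu : u ∈ weyl n) :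
    SingleOrbit (lam Q) (u (lam P)) := by
  intro α hα α' hα' hx hy hw
  have hx' := (inner_ne_zero_of_orbit hα hx hy (by obtain ⟨w, -, h⟩ := hw; exact ⟨w, h⟩)).1
  wlog hpos : 0 < ⟪α, lam Q⟫ generalizing α
  · obtain ⟨v, hv, h₁, h₂, h₃⟩ := this (-α) (neg_mem_roots hα) (by rwa [inner_neg_left, neg_ne_zero])
      (by rwa [inner_neg_left, neg_ne_zero]) (by rwa [refl_neg]) (by
        rw [inner_neg_left]
        have := lt_of_le_of_ne (not_lt.1 hpos) hx
        linarith)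
    refine ⟨v, hv, h₁, h₂, ?_⟩
    rw [map_neg, neg_inj, neg_eq_iff_eq_neg] at h₃
    exact h₃.symm
  wlog hpos' : 0 < ⟪α', lam Q⟫ generalizing α'
  · obtain ⟨v, hv, h₁, h₂, h₃⟩ := this (-α') (neg_mem_roots hα')
      (by rwa [inner_neg_left, neg_ne_zero]) (by rwa [refl_neg]) (by
        rw [inner_neg_left]
        have := lt_of_le_of_ne (not_lt.1 hpos') hx'
        linarith)
    refine ⟨v, hv, h₁, h₂, ?_⟩
    rw [neg_neg] at h₃
    exact h₃.symm
  obtain ⟨w, hw, hwQ, hwα⟩ := hw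
  have hw' := mem_parabolic_of_map_lam hw hwQ
  have hin := inner_map_right_of_fixed hwQ (refl α (u (lam P)))
  rw [hwα, inner_refl_right, inner_refl_right, sub_right_inj] at hin
  have hα₀ := inner_self_root_pos hα
  have hα₀' := inner_self_root_pos hα'
  rcases lt_or_gt_of_ne hy with hneg | hy
  -- Here the edges of `G^P` point towards `u (lam P)`, so the comparison uses the two reflected
  -- points as sources. Equal pairings with `lam Q` give `α` and `α'` the same sign on `u (lam P)`.
  · have hy' : ⟪α', u (lam P)⟫ < 0 := by
      by_contra! hc
      have h₁ : 0 ≤ 2 * (⟪α', lam Q⟫ * ⟪α', u (lam P)⟫) / ⟪α', α'⟫ := by positivity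
      have h₂ : 2 * (⟪α, lam Q⟫ * ⟪α, u (lam P)⟫) / ⟪α, α⟫ < 0 :=
        div_neg_of_neg_of_pos (by nlinarith) hα₀
      linarith
    obtain ⟨v, hv, h₁, h₂⟩ := D.exists_map_of_isClosed h (refl_mul_mem_weyl hα hu)
      (refl_mul_mem_weyl hα' hu) hα hα' hpos
      (by rw [refl_mul_apply_lam, inner_self_refl]; linarith) hpos'
      (by rw [refl_mul_apply_lam, inner_self_refl]; linarith) ⟨w, hw', hwα.symm⟩
      ⟨1, one_mem _, by
        rw [refl_mul_apply_lam, refl_mul_apply_lam, refl_refl_apply, refl_refl_apply]; rfl⟩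
    refine ⟨v, parabolic_le_weyl _ hv, map_lam hv, ?_, Or.inl h₂⟩
    rw [refl_mul_apply_lam, refl_mul_apply_lam, map_refl, h₂] at h₁
    exact (refl α').injective h₁
  · have hy' : 0 < ⟪α', u (lam P)⟫ := by
      by_contra! hc
      have h₁ : 0 < 2 * (⟪α, lam Q⟫ * ⟪α, u (lam P)⟫) / ⟪α, α⟫ := by positivity
      have h₂ : 2 * (⟪α', lam Q⟫ * ⟪α', u (lam P)⟫) / ⟪α', α'⟫ ≤ 0 :=
        div_nonpos_of_nonpos_of_nonneg (by nlinarith) hα₀'.le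
      linarith
    obtain ⟨v, hv, h₁, h₂⟩ := D.exists_map_of_isClosed h hu hu hα hα' hpos hy hpos' hy'
      ⟨1, one_mem _, rfl⟩ ⟨w, hw', hwα.symm⟩
    exact ⟨v, parabolic_le_weyl _ hv, map_lam hv, h₁, Or.inl h₂⟩

/-- The right side does not involve the labels, so closedness is the same for every choice. -/
theorem isClosed_iff : D.IsClosed ↔ ∀ u ∈ weyl n, SingleOrbit (lam Q) (u (lam P)) :=
  ⟨fun h _ hu => D.singleOrbit_of_isClosed h hu, D.isClosed_of_singleOrbit⟩

end DoubleMomentGraph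

end Closedness

/-! ### Orbits of reflections for pairs of vectors -/

section Orbits

variable {n : ℕ}

/-- Replacing `w` by `refl α' * w * refl α` exchanges the roles of the two vectors. -/
theorem SingleOrbit.symm {x y : Space n} (h : SingleOrbit x y) : SingleOrbit y x := by
  rintro α hα α' hα' hy hx ⟨w, hw, hwy, hwx⟩
  obtain ⟨v, hv, h₁, h₂, h₃⟩ := h α hα α' hα' hx hy
    ⟨refl α' * (w * refl α), mul_mem (refl_mem_weyl hα') (mul_mem hw (refl_mem_weyl hα)),
      by rw [mul_apply, mul_apply, hwx, refl_refl_apply],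
      by rw [mul_apply, mul_apply, refl_refl_apply, hwy]⟩
  exact ⟨v, hv, h₂, h₁, h₃⟩

theorem SingleOrbit.map {x y : Space n} (h : SingleOrbit x y) {g : Isom n} (hg : g ∈ weyl n) :
    SingleOrbit (g x) (g y) := by
  rintro α hα α' hα' hx hy ⟨w, hw, hwx, hwy⟩
  rw [inner_map_right] at hx hy
  obtain ⟨v, hv, h₁, h₂, h₃⟩ := h (g⁻¹ α) (map_mem_roots (inv_mem hg) hα) (g⁻¹ α')
    (map_mem_roots (inv_mem hg) hα') hx hy ⟨g⁻¹ * (w * g), mul_mem (inv_mem hg) (mul_mem hw hg),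
      by rw [mul_apply, mul_apply, hwx, inv_apply_self],
      by
        rw [mul_apply, mul_apply, map_refl g, apply_inv_self, hwy, map_refl g⁻¹, inv_apply_self]⟩
  refine ⟨g * (v * g⁻¹), mul_mem hg (mul_mem hv (inv_mem hg)), ?_, ?_, ?_⟩
  · rw [mul_apply, mul_apply, inv_apply_self, h₁]
  · rw [mul_apply, mul_apply, inv_apply_self, h₂]
  · rw [mul_apply, mul_apply]
    rcases h₃ with h₃ | h₃
    · left
      rw [h₃, apply_inv_self]
    · right
      rw [h₃, map_neg, apply_inv_self]

theorem singleOrbit_zero_right (x : Space n) : SingleOrbit x 0 :=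
  fun _ _ _ _ _ h => absurd (inner_zero_right _) h

theorem singleOrbit_zero_left (y : Space n) : SingleOrbit 0 y :=
  fun _ _ _ _ h => absurd (inner_zero_right _) h

/-- Two vectors `±e_i` on which `x` and `y` take the same values are exchanged by an element of
the Weyl group fixing `x`, `y` and everything orthogonal to the two vectors. -/
theorem exists_move {u u' : Space n} (hu : u ∈ signedBasis n) (hu' : u' ∈ signedBasis n)
    {x y : Space n} (hx : ⟪u, x⟫ = ⟪u', x⟫) (hy : ⟪u, y⟫ = ⟪u', y⟫) :
    ∃ w ∈ weyl n, w x = x ∧ w y = y ∧ w u = u' ∧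
      ∀ b, ⟪u, b⟫ = 0 → ⟪u', b⟫ = 0 → w b = b := by
  by_cases h : u = u'
  · exact ⟨1, one_mem _, rfl, rfl, h, fun _ _ _ => rfl⟩
  · refine ⟨refl (u - u'), refl_mem_weyl (mem_roots_iff.2 ⟨u, hu, -u', neg_mem_signedBasis hu',
      by rwa [neg_neg], sub_eq_add_neg _ _⟩), ?_, ?_, refl_sub_left hu hu' h, fun b h₁ h₂ => ?_⟩
    all_goals refine refl_of_inner_eq_zero ?_
    all_goals rw [inner_sub_left]
    · rw [hx, sub_self]
    · rw [hy, sub_self]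
    · rw [h₁, h₂, sub_self]

theorem inner_signedBasis_sq {u b : Space n} (hu : u ∈ signedBasis n) (hb : b ∈ signedBasis n) :
    ⟪u, b⟫ = 1 ∨ ⟪u, b⟫ = -1 ∨ ⟪u, b⟫ = 0 := by
  rcases signedBasis_cases hu hb with rfl | rfl | h
  · exact Or.inl (inner_self_signedBasis hu)
  · rw [inner_neg_left, inner_self_signedBasis hb]
    exact Or.inr (Or.inl rfl)
  · exact Or.inr (Or.inr h)

/-- Norms allow `r ^ 2` to be 1, 2 or 1/2; pairing with a summand `u` of `α` makes it a ratio of the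
squares 1 and 4, leaving only 1. -/
theorem eq_or_eq_neg_of_root_smul {α α' : Space n} (hα : α ∈ roots n) (hα' : α' ∈ roots n)
    {r : ℝ} (h : α = r • α') : α = α' ∨ α = -α' := by
  have h₁ : ⟪α, α⟫ = r ^ 2 * ⟪α', α'⟫ := by
    rw [h, real_inner_smul_left, real_inner_smul_right]
    ring
  obtain ⟨u, hu, v, hv, huv, hαuv⟩ := mem_roots_iff.1 hα
  obtain ⟨u', hu', v', hv', -, hαuv'⟩ := mem_roots_iff.1 hα'
  have h₂ : ⟪α, u⟫ ^ 2 = r ^ 2 * ⟪α', u⟫ ^ 2 := by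
    rw [h, real_inner_smul_left]
    ring
  have h₃ : ⟪α, u⟫ = 1 ∨ ⟪α, u⟫ = 2 := by
    rw [hαuv, inner_add_left, inner_self_signedBasis hu]
    rcases signedBasis_cases hv hu with rfl | rfl | h'
    · rw [inner_self_signedBasis hu]
      norm_num
    · rw [neg_neg] at huv
      exact absurd rfl huv
    · rw [h']
      norm_num
  have h₄ : ⟪α', u⟫ ^ 2 = 0 ∨ ⟪α', u⟫ ^ 2 = 1 ∨ ⟪α', u⟫ ^ 2 = 4 := by
    rw [hαuv', inner_add_left]
    rcases inner_signedBasis_sq hu' hu with h | h | h <;>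
      rcases inner_signedBasis_sq hv' hu with h' | h' | h' <;> rw [h, h'] <;> norm_num
  have h₅ : r ^ 2 = 1 := by
    rcases inner_self_root hα with h₆ | h₆ <;> rcases inner_self_root hα' with h₇ | h₇ <;>
      rw [h₆, h₇] at h₁ <;> rcases h₃ with h₃ | h₃ <;> rcases h₄ with h₄ | h₄ | h₄ <;>
      rw [h₃, h₄] at h₂ <;> linarith
  rcases sq_eq_one_iff.1 h₅ with rfl | rfl
  · exact Or.inl (by rw [h, one_smul])
  · exact Or.inr (by rw [h, neg_smul, one_smul])

theorem eq_one_of_fixed {w : Isom n} (hw : w ∈ weyl n) {y : Space n}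
    (hy : ∀ b ∈ signedBasis n, ∀ b' ∈ signedBasis n, ⟪b, y⟫ = ⟪b', y⟫ → b = b')
    (h : w y = y) : w = 1 := by
  have h' : ∀ b ∈ signedBasis n, w b = b := fun b hb =>
    hy _ (isSigned_of_mem_weyl hw b hb) b hb (inner_map_left_of_fixed h b)
  ext1 v
  refine ext_inner_signedBasis fun u hu => ?_
  conv_lhs => rw [← h' u hu]
  exact inner_map w u v

/-- The stabilizer of `y` is trivial, so `w = refl α' * refl α`. As `w` fixes `x`, both reflections
move `x` to the same point, and the roots are proportional. -/
theorem singleOrbit_of_injective {x y : Space n}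
    (hy : ∀ b ∈ signedBasis n, ∀ b' ∈ signedBasis n, ⟪b, y⟫ = ⟪b', y⟫ → b = b') :
    SingleOrbit x y := by
  rintro α hα α' hα' hx - ⟨w, hw, hwx, hwy⟩
  have h₁ : refl α' * (w * refl α) = 1 := by
    refine eq_one_of_fixed (mul_mem (refl_mem_weyl hα') (mul_mem hw (refl_mem_weyl hα))) hy ?_
    rw [mul_apply, mul_apply, hwy, refl_refl_apply]
  have h₂ : refl α x = refl α' x := by
    have h₃ : w * refl α = refl α' := by
      rw [← refl_inv α']
      exact (inv_eq_of_mul_eq_one_right h₁).symm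
    have h₄ : w = refl α' * refl α := by
      rw [← h₃, mul_assoc, refl_mul_self, mul_one]
    rw [h₄, mul_apply] at hwx
    rw [← refl_refl_apply α' (refl α x), hwx]
  rw [refl_apply, refl_apply, sub_right_inj] at h₂
  have hc : 2 * ⟪α, x⟫ / ⟪α, α⟫ ≠ 0 :=
    div_ne_zero (mul_ne_zero two_ne_zero hx) (inner_self_root_pos hα).ne'
  refine ⟨1, one_mem _, rfl, rfl, ?_⟩
  change α = α' ∨ α = -α'
  refine eq_or_eq_neg_of_root_smul hα hα'
    (r := (2 * ⟪α, x⟫ / ⟪α, α⟫)⁻¹ * (2 * ⟪α', x⟫ / ⟪α', α'⟫)) ?_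
  rw [mul_smul, ← h₂, smul_smul, inv_mul_cancel₀ hc, one_smul]

/-- The nonzero values `±x_i` of `x` are pairwise distinct. -/
def Separated (x : Space n) : Prop :=
  ∀ b ∈ signedBasis n, ∀ b' ∈ signedBasis n, ⟪b, x⟫ = ⟪b', x⟫ → ⟪b, x⟫ ≠ 0 → b = b'

theorem Separated.map {x : Space n} (hx : Separated x) {g : Isom n} (hg : g ∈ weyl n) :
    Separated (g x) := by
  intro b hb b' hb' h₁ h₂
  rw [inner_map_right, inner_map_right] at h₁
  rw [inner_map_right] at h₂
  have hg' := isSigned_of_mem_weyl (inv_mem hg)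
  exact (g⁻¹).injective (hx _ (hg' b hb) _ (hg' b' hb') h₁ h₂)

theorem eq_of_refl_add_ne {u v b : Space n} (hu : u ∈ signedBasis n) (hv : v ∈ signedBasis n)
    (hb : b ∈ signedBasis n) (h : refl (u + v) b ≠ b) : b = u ∨ b = -u ∨ b = v ∨ b = -v := by
  rcases signedBasis_cases hu hb with rfl | rfl | h₁
  · simp
  · simp
  rcases signedBasis_cases hv hb with rfl | rfl | h₂
  · simp
  · simp
  exact absurd (refl_add_of_inner_eq_zero h₁ h₂) h

theorem inner_left_refl_add {u v : Space n} (hu : u ∈ signedBasis n) (hv : v ∈ signedBasis n)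
    (huv : u ≠ -v) (y : Space n) : ⟪u, refl (u + v) y⟫ = -⟪v, y⟫ := by
  rw [← inner_refl_left, refl_add_left hu hv huv, inner_neg_left]

theorem inner_right_refl_add {u v : Space n} (hu : u ∈ signedBasis n) (hv : v ∈ signedBasis n)
    (huv : u ≠ -v) (y : Space n) : ⟪v, refl (u + v) y⟫ = -⟪u, y⟫ := by
  rw [← inner_refl_left, refl_add_right hu hv huv, inner_neg_left]

/-- The value at `u` after reflecting is `-⟪v, y⟫`, so `v` and `v'` agree on `y` and separation
identifies them unless this value is 0. If it is 0 but `⟪v, x⟫ ≠ 0`, the value at `v` can be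
compared as well. -/
theorem Separated.eq_or_inner_eq_zero {x y u v v' : Space n} (hy : Separated y)
    (hu : u ∈ signedBasis n) (hv : v ∈ signedBasis n) (hv' : v' ∈ signedBasis n)
    (hfix : ∀ b ∈ signedBasis n, ⟪b, x⟫ ≠ 0 → ⟪b, refl (u + v) y⟫ = ⟪b, refl (u + v') y⟫)
    (huv : u ≠ -v) (huv' : u ≠ -v') (hyu : ⟪u, y⟫ + ⟪v, y⟫ ≠ 0) (hxu : ⟪u, x⟫ ≠ 0) :
    v = v' ∨ (⟪v, y⟫ = 0 ∧ ⟪v, x⟫ = 0) := by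
  have h₁ := hfix u hu hxu
  rw [inner_left_refl_add hu hv huv, inner_left_refl_add hu hv' huv', neg_inj] at h₁
  by_cases hvy : ⟪v, y⟫ = 0
  · refine or_iff_not_imp_right.2 fun hne => ?_
    have hvx : ⟪v, x⟫ ≠ 0 := fun h => hne ⟨hvy, h⟩
    have hyu' : ⟪u, y⟫ ≠ 0 := by rwa [hvy, add_zero] at hyu
    have h₂ := hfix v hv hvx
    rw [inner_right_refl_add hu hv huv] at h₂
    have h₃ : refl (u + v') v ≠ v := by
      intro h
      rw [← inner_refl_left, h, hvy] at h₂
      exact hyu' (neg_eq_zero.1 h₂)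
    rcases eq_of_refl_add_ne hu hv' hv h₃ with h | h | h | h
    · rw [h] at hvy
      exact absurd hvy hyu'
    · rw [h, inner_neg_left, neg_eq_zero] at hvy
      exact absurd hvy hyu'
    · exact h
    · rw [h, inner_neg_left, inner_right_refl_add hu hv' huv', neg_neg] at h₂
      exact absurd (self_eq_neg.1 h₂.symm) hyu'
  · exact Or.inl (hy v hv v' hv' h₁ hvy)

theorem Separated.exists_map_eq {x y u v α' : Space n} (hy : Separated y)
    (hu : u ∈ signedBasis n) (hv : v ∈ signedBasis n) (huv : u ≠ -v) (hα' : α' ∈ roots n)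
    (hyu : ⟪u, y⟫ + ⟪v, y⟫ ≠ 0) (hyα' : ⟪α', y⟫ ≠ 0)
    (hfix : ∀ b ∈ signedBasis n, ⟪b, x⟫ ≠ 0 → ⟪b, refl (u + v) y⟫ = ⟪b, refl α' y⟫)
    (hxu : ⟪u, x⟫ ≠ 0) :
    ∃ w ∈ weyl n, w x = x ∧ w y = y ∧ (w (u + v) = α' ∨ w (u + v) = -α') := by
  have key : ∀ v' ∈ signedBasis n, u ≠ -v' → ⟪u + v', y⟫ ≠ 0 → refl (u + v') = refl α' →
      ∃ w ∈ weyl n, w x = x ∧ w y = y ∧ w (u + v) = u + v' := by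
    intro v' hv' huv' hyv' hr
    rw [← hr] at hfix
    rw [inner_add_left] at hyv'
    have hvv' : v = v' ∨ (⟪v, x⟫ = ⟪v', x⟫ ∧ ⟪v, y⟫ = ⟪v', y⟫ ∧ ⟪u, y⟫ ≠ 0 ∧ ⟪v, y⟫ = 0) := by
      rcases hy.eq_or_inner_eq_zero hu hv hv' hfix huv huv' hyu hxu with h | ⟨h₁, h₂⟩
      · exact Or.inl h
      rcases hy.eq_or_inner_eq_zero hu hv' hv (fun b hb hbx => (hfix b hb hbx).symm) huv' huv
        hyv' hxu with h | ⟨h₃, h₄⟩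
      · exact Or.inl h.symm
      · rw [h₁, add_zero] at hyu
        exact Or.inr ⟨by rw [h₂, h₄], by rw [h₁, h₃], hyu, h₁⟩
    -- Either the roots coincide, or `v` and `v'` vanish on both vectors and can be exchanged with
    -- `u` fixed.
    rcases hvv' with rfl | ⟨h₁, h₂, h₃, h₄⟩
    · exact ⟨1, one_mem _, rfl, rfl, rfl⟩
    · obtain ⟨w, hw, hwx, hwy, hwv, hwb⟩ := exists_move hv hv' h₁ h₂
      refine ⟨w, hw, hwx, hwy, ?_⟩
      rw [map_add, hwv, hwb]
      · refine inner_eq_zero_of_ne hv hu (fun h => ?_) fun h => huv ?_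
        · rw [h] at h₄
          exact h₃ h₄
        · rw [h, neg_neg]
      · refine inner_eq_zero_of_ne hv' hu (fun h => ?_) fun h => huv' ?_
        · rw [h₂, h] at h₄
          exact h₃ h₄
        · rw [h, neg_neg]
  obtain ⟨u', hu', v', hv', huv', rfl⟩ := mem_roots_iff.1 hα'
  have hu'v : -u' ≠ v' := fun h => huv' (by rw [← h, neg_neg])
  have hmoved : refl (u' + v') u ≠ u := by
    intro h
    have h₁ := hfix u hu hxu
    rw [inner_left_refl_add hu hv huv, ← inner_refl_left, h] at h₁
    apply hyu
    rw [← h₁]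
    ring
  rcases eq_of_refl_add_ne hu' hv' hu hmoved with rfl | rfl | rfl | rfl
  · obtain ⟨w, hw, h₁, h₂, h₃⟩ := key v' hv' huv' hyα' rfl
    exact ⟨w, hw, h₁, h₂, Or.inl h₃⟩
  · obtain ⟨w, hw, h₁, h₂, h₃⟩ := key (-v') (neg_mem_signedBasis hv') (by
      intro h
      exact huv' (neg_injective h))
      (by rwa [← neg_add, inner_neg_left, neg_ne_zero]) (by rw [← neg_add, refl_neg])
    refine ⟨w, hw, h₁, h₂, Or.inr ?_⟩
    rw [h₃, neg_add]
  · obtain ⟨w, hw, h₁, h₂, h₃⟩ := key u' hu' (fun h => hu'v h.symm) (by rwa [add_comm])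
      (by rw [add_comm])
    refine ⟨w, hw, h₁, h₂, Or.inl ?_⟩
    rw [h₃, add_comm]
  · obtain ⟨w, hw, h₁, h₂, h₃⟩ := key (-u') (neg_mem_signedBasis hu') (by
      intro h
      rw [neg_neg] at h
      exact huv' h.symm)
      (by rwa [← neg_add, inner_neg_left, neg_ne_zero, add_comm])
      (by rw [← neg_add, refl_neg, add_comm])
    refine ⟨w, hw, h₁, h₂, Or.inr ?_⟩
    rw [h₃, neg_add, add_comm]

/-- An element fixing a separated `x` fixes every signed basis vector not orthogonal to `x`. So both
reflections of `y` agree on these vectors, and one of the summands of `α` is among them. -/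
theorem Separated.singleOrbit {x y : Space n} (hx : Separated x) (hy : Separated y) :
    SingleOrbit x y := by
  rintro α hα α' hα' hxα hyα ⟨w, hw, hwx, hwy⟩
  have hyα' := (inner_ne_zero_of_orbit hα hxα hyα ⟨w, hwx, hwy⟩).2
  obtain ⟨u, hu, v, hv, huv, rfl⟩ := mem_roots_iff.1 hα
  rw [inner_add_left] at hxα hyα
  have hfix : ∀ b ∈ signedBasis n, ⟪b, x⟫ ≠ 0 → ⟪b, refl (u + v) y⟫ = ⟪b, refl α' y⟫ := by
    intro b hb hbx
    have h₁ : b = w b := by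
      refine hx b hb _ (isSigned_of_mem_weyl hw b hb) ?_ hbx
      exact (inner_map_left_of_fixed hwx b).symm
    rw [← hwy]
    conv_rhs => rw [h₁]
    rw [inner_map]
  by_cases hxu : ⟪u, x⟫ = 0
  · rw [hxu, zero_add] at hxα
    rw [add_comm] at hfix hyα ⊢
    exact hy.exists_map_eq hv hu (fun h => huv (by rw [h, neg_neg])) hα' hyα hyα' hfix hxα
  · exact hy.exists_map_eq hu hv huv hα' hyα hyα' hfix hxu

end Orbits

/-! ### Vectors without zero coordinates, by counting pairs of values; the obstruction to single
orbits -/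

section Counting

variable {n : ℕ}

theorem finite_signedBasis (n : ℕ) : (signedBasis n).Finite := by
  refine ((Set.finite_range (e : Fin n → Space n)).union
    (Set.finite_range fun i : Fin n => -(e i : Space n))).subset ?_
  rintro u ⟨i, rfl | rfl⟩
  · exact Or.inl ⟨i, rfl⟩
  · exact Or.inr ⟨i, rfl⟩

/-- The vectors `±e_i` on which `x` and `y` take the values `p` and `q`. -/
def fiber (x y : Space n) (p q : ℝ) : Set (Space n) :=
  {b | b ∈ signedBasis n ∧ ⟪b, x⟫ = p ∧ ⟪b, y⟫ = q}

theorem finite_fiber (x y : Space n) (p q : ℝ) : (fiber x y p q).Finite :=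
  (finite_signedBasis n).subset fun _ hb => hb.1

/-- Fiber sizes are the invariants of a pair of vectors under `W` that replace the pointwise
comparison available for separated vectors. -/
theorem ncard_fiber_le_map {w : Isom n} (hw : w ∈ weyl n) (x y : Space n) (p q : ℝ) :
    (fiber x y p q).ncard ≤ (fiber (w x) (w y) p q).ncard := by
  refine Set.ncard_le_ncard_of_injOn w ?_ w.injective.injOn (finite_fiber _ _ _ _)
  rintro b ⟨hb, h₁, h₂⟩
  exact ⟨isSigned_of_mem_weyl hw b hb, by rwa [inner_map], by rwa [inner_map]⟩

theorem ncard_fiber_map {w : Isom n} (hw : w ∈ weyl n) (x y : Space n) (p q : ℝ) :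
    (fiber (w x) (w y) p q).ncard = (fiber x y p q).ncard := by
  refine le_antisymm ?_ (ncard_fiber_le_map hw x y p q)
  have := ncard_fiber_le_map (inv_mem hw) (w x) (w y) p q
  rwa [inv_apply_self, inv_apply_self] at this

theorem fiber_subset_refl {α x y : Space n} {p q : ℝ}
    (h : ∀ b ∈ fiber x y p q, refl α b = b) : fiber x y p q ⊆ fiber x (refl α y) p q := by
  intro b hb
  refine ⟨hb.1, hb.2.1, ?_⟩
  rw [← inner_refl_left, h b hb]
  exact hb.2.2

theorem ncard_fiber_le_refl {α x y : Space n} {p q : ℝ}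
    (h : ∀ b ∈ fiber x y p q, refl α b = b) :
    (fiber x y p q).ncard ≤ (fiber x (refl α y) p q).ncard :=
  Set.ncard_le_ncard (fiber_subset_refl h) (finite_fiber _ _ _ _)

theorem ncard_fiber_lt_refl {α x y u : Space n} {p q : ℝ}
    (h : ∀ b ∈ fiber x y p q, refl α b = b) (hu : u ∈ fiber x (refl α y) p q)
    (hu' : u ∉ fiber x y p q) :
    (fiber x y p q).ncard < (fiber x (refl α y) p q).ncard :=
  Set.ncard_lt_ncard ⟨fiber_subset_refl h, fun h' => hu' (h' hu)⟩ (finite_fiber _ _ _ _)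

/-- All coordinates of `x` are nonzero. -/
def NonvanishingOnBasis (x : Space n) : Prop := ∀ b ∈ signedBasis n, ⟪b, x⟫ ≠ 0

theorem NonvanishingOnBasis.map {x : Space n} (hx : NonvanishingOnBasis x) {g : Isom n}
    (hg : g ∈ weyl n) : NonvanishingOnBasis (g x) := by
  intro b hb
  rw [inner_map_right]
  exact hx _ (isSigned_of_mem_weyl (inv_mem hg) b hb)

variable {x y : Space n}

theorem notMem_fiber_of_moved (hx : NonvanishingOnBasis x) (hy : NonvanishingOnBasis y)
    {u v b : Space n} (hu : u ∈ signedBasis n) (hv : v ∈ signedBasis n) (huv : u ≠ -v)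
    (hxα : ⟪u, x⟫ + ⟪v, x⟫ ≠ 0) (hyα : ⟪u, y⟫ + ⟪v, y⟫ ≠ 0)
    (hb : b ∈ fiber x (refl (u + v) y) ⟪u, x⟫ ⟪u, y⟫) : refl (u + v) b = b := by
  by_contra hne
  obtain ⟨hbB, h₁, h₂⟩ := hb
  have hxu := hx u hu
  have hyu := hy u hu
  rcases eq_of_refl_add_ne hu hv hbB hne with rfl | rfl | rfl | rfl
  · rw [inner_left_refl_add hu hv huv] at h₂
    exact hyα (by linarith)
  · rw [inner_neg_left] at h₁
    exact hxu (by linarith)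
  · rw [inner_right_refl_add hu hv huv] at h₂
    exact hyu (by linarith)
  · rw [inner_neg_left] at h₁
    exact hxα (by linarith)

/-- If the pair of values on `u` is destroyed by the reflection in `u + v`, it is destroyed by
every other reflection with the same effect on the fibers. -/
theorem exists_moved_mem_fiber (hx : NonvanishingOnBasis x) (hy : NonvanishingOnBasis y)
    {u v α' : Space n} (hu : u ∈ signedBasis n) (hv : v ∈ signedBasis n) (huv : u ≠ -v)
    (hxα : ⟪u, x⟫ + ⟪v, x⟫ ≠ 0) (hyα : ⟪u, y⟫ + ⟪v, y⟫ ≠ 0)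
    (hcard : ∀ p q, (fiber x (refl (u + v) y) p q).ncard = (fiber x (refl α' y) p q).ncard) :
    ∃ b ∈ fiber x y ⟪u, x⟫ ⟪u, y⟫, refl α' b ≠ b := by
  by_contra! hc
  have h₁ := ncard_fiber_le_refl hc
  -- Going back from the reflected vector to `y`, the fiber gains `u` and loses nothing.
  have h₂ := ncard_fiber_lt_refl (α := u + v) (u := u)
    (fun b hb => notMem_fiber_of_moved hx hy hu hv huv hxα hyα hb)
    ⟨hu, rfl, by rw [refl_refl_apply]⟩ (fun h => by
      have h₃ := h.2.2
      rw [inner_left_refl_add hu hv huv] at h₃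
      exact hyα (by linarith))
  rw [refl_refl_apply, hcard] at h₂
  exact absurd h₁ (not_le.2 h₂)

/-- Some vector with the values of `v` is moved by `u + v'`, hence is `±u` or `±v'`. The sign
assumptions and `hne` exclude `±u`. For `-v'`, the fiber at `(⟪u, x⟫, -⟪v, y⟫)` grows under `u + v`
but not under `u + v'`. -/
theorem values_eq_of_ne (hx : NonvanishingOnBasis x) (hy : NonvanishingOnBasis y)
    {u v v' : Space n} (hu : u ∈ signedBasis n) (hv : v ∈ signedBasis n)
    (hv' : v' ∈ signedBasis n) (huv : u ≠ -v) (huv' : u ≠ -v')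
    (hxα : ⟪u, x⟫ + ⟪v, x⟫ ≠ 0) (hyα : ⟪u, y⟫ + ⟪v, y⟫ ≠ 0)
    (hcard : ∀ p q,
      (fiber x (refl (u + v) y) p q).ncard = (fiber x (refl (u + v') y) p q).ncard)
    (hne : ¬(⟪v, x⟫ = ⟪u, x⟫ ∧ ⟪v, y⟫ = ⟪u, y⟫)) :
    ⟪v, x⟫ = ⟪v', x⟫ ∧ ⟪v, y⟫ = ⟪v', y⟫ := by
  have hxu := hx u hu
  have hyv := hy v hv
  have hcard' := hcard
  rw [add_comm u v] at hcard'
  obtain ⟨b, ⟨hbB, h₁, h₂⟩, hb⟩ := exists_moved_mem_fiber hx hy hv hu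
    (fun h => huv (by rw [h, neg_neg])) (by rwa [add_comm]) (by rwa [add_comm]) hcard'
  rcases eq_of_refl_add_ne hu hv' hbB hb with rfl | rfl | rfl | rfl
  · exact absurd ⟨h₁.symm, h₂.symm⟩ hne
  · rw [inner_neg_left] at h₁
    exact absurd (by linarith) hxα
  · exact ⟨h₁.symm, h₂.symm⟩
  rw [inner_neg_left] at h₁ h₂
  exfalso
  have hlt : (fiber x y ⟪u, x⟫ (-⟪v, y⟫)).ncard <
      (fiber x (refl (u + v) y) ⟪u, x⟫ (-⟪v, y⟫)).ncard := by
    refine ncard_fiber_lt_refl (u := u) ?_ ⟨hu, rfl, inner_left_refl_add hu hv huv y⟩ ?_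
    · rintro c ⟨hc, h₃, h₄⟩
      by_contra hmoved
      rcases eq_of_refl_add_ne hu hv hc hmoved with rfl | rfl | rfl | rfl
      · exact hyα (by linarith)
      · rw [inner_neg_left] at h₃
        exact hxu (by linarith)
      · exact hyv (by linarith)
      · rw [inner_neg_left] at h₃
        exact hxα (by linarith)
    · rintro ⟨-, -, h⟩
      exact hyα (by linarith)
  have hle : (fiber x (refl (u + v') y) ⟪u, x⟫ (-⟪v, y⟫)).ncard ≤
      (fiber x y ⟪u, x⟫ (-⟪v, y⟫)).ncard := by
    have := ncard_fiber_le_refl (α := u + v') (x := x) (y := refl (u + v') y) (p := ⟪u, x⟫)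
      (q := -⟪v, y⟫) ?_
    · rwa [refl_refl_apply] at this
    rintro c ⟨hc, h₃, h₄⟩
    by_contra hmoved
    rcases eq_of_refl_add_ne hu hv' hc hmoved with rfl | rfl | rfl | rfl
    · rw [inner_left_refl_add hu hv' huv'] at h₄
      exact hyv (by linarith)
    · rw [inner_neg_left] at h₃
      exact hxu (by linarith)
    · exact hxα (by linarith)
    · rw [inner_neg_left, inner_right_refl_add hu hv' huv'] at h₄
      exact hyα (by linarith)
  rw [← hcard] at hle
  exact absurd hlt (not_lt.2 hle)

theorem exists_map_eq_of_common (hx : NonvanishingOnBasis x) (hy : NonvanishingOnBasis y)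
    {u v v' : Space n} (hu : u ∈ signedBasis n) (hv : v ∈ signedBasis n)
    (hv' : v' ∈ signedBasis n) (huv : u ≠ -v) (huv' : u ≠ -v')
    (hxα : ⟪u, x⟫ + ⟪v, x⟫ ≠ 0) (hyα : ⟪u, y⟫ + ⟪v, y⟫ ≠ 0)
    (hxα' : ⟪u, x⟫ + ⟪v', x⟫ ≠ 0) (hyα' : ⟪u, y⟫ + ⟪v', y⟫ ≠ 0)
    (hcard : ∀ p q,
      (fiber x (refl (u + v) y) p q).ncard = (fiber x (refl (u + v') y) p q).ncard)
    (hinner : ⟪x, refl (u + v) y⟫ = ⟪x, refl (u + v') y⟫) :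
    ∃ w ∈ weyl n, w x = x ∧ w y = y ∧ w (u + v) = u + v' := by
  have hval : ⟪v, x⟫ = ⟪v', x⟫ ∧ ⟪v, y⟫ = ⟪v', y⟫ := by
    by_cases h₁ : ⟪v, x⟫ = ⟪u, x⟫ ∧ ⟪v, y⟫ = ⟪u, y⟫
    · by_cases h₂ : ⟪v', x⟫ = ⟪u, x⟫ ∧ ⟪v', y⟫ = ⟪u, y⟫
      · exact ⟨h₁.1.trans h₂.1.symm, h₁.2.trans h₂.2.symm⟩
      · have h₃ := values_eq_of_ne hx hy hu hv' hv huv' huv hxα' hyα'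
          (fun p q => (hcard p q).symm) h₂
        exact ⟨h₃.1.symm, h₃.2.symm⟩
    · exact values_eq_of_ne hx hy hu hv hv' huv huv' hxα hyα hcard h₁
  -- Fibers cannot separate `2u` from `u + v` when `u` and `v` have equal values; the pairing with
  -- `x` can, since it records the root length.
  have hnorm : ⟪u + v, u + v⟫ = ⟪u + v', u + v'⟫ := by
    rw [inner_refl_right, inner_refl_right, sub_right_inj, inner_add_left u v x,
      inner_add_left u v y, inner_add_left u v' x, inner_add_left u v' y, ← hval.1, ← hval.2]
      at hinner
    have h₁ := (inner_self_root_pos (mem_roots_iff.2 ⟨u, hu, v, hv, huv, rfl⟩)).ne'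
    have h₂ := (inner_self_root_pos (mem_roots_iff.2 ⟨u, hu, v', hv', huv', rfl⟩)).ne'
    rw [div_eq_div_iff h₁ h₂] at hinner
    exact (mul_left_cancel₀ (mul_ne_zero two_ne_zero (mul_ne_zero hxα hyα)) hinner).symm
  have huu := inner_self_signedBasis hu
  have hvv := inner_self_signedBasis hv
  have hvv' := inner_self_signedBasis hv'
  rw [inner_add_add_self, inner_add_add_self, real_inner_comm u v, real_inner_comm u v'] at hnorm
  have huvv' : ⟪u, v⟫ = ⟪u, v'⟫ := by linarith
  rcases signedBasis_cases hv hu with rfl | rfl | h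
  · rcases signedBasis_cases hv' hv with rfl | rfl | h'
    · exact ⟨1, one_mem _, rfl, rfl, rfl⟩
    · exact absurd (neg_neg _).symm huv'
    · rw [huu, real_inner_comm, h'] at huvv'
      norm_num at huvv'
  · exact absurd (neg_neg _).symm huv
  · obtain ⟨w, hw, hwx, hwy, hwv, hwb⟩ := exists_move hv hv' hval.1 hval.2
    refine ⟨w, hw, hwx, hwy, ?_⟩
    rw [map_add, hwv, hwb u h]
    rw [real_inner_comm, ← huvv', real_inner_comm]
    exact h

/-- Some vector with the values of `u` is moved by `refl α'`, so up to sign it is a summand of `α'`.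
An element fixing `x` and `y` moves `u` onto it, which reduces to roots with a common summand. -/
theorem NonvanishingOnBasis.singleOrbit (hx : NonvanishingOnBasis x)
    (hy : NonvanishingOnBasis y) : SingleOrbit x y := by
  rintro α hα α' hα' hxα hyα ⟨w, hw, hwx, hwy⟩
  obtain ⟨hxα', hyα'⟩ := inner_ne_zero_of_orbit hα hxα hyα ⟨w, hwx, hwy⟩
  have hcard : ∀ p q, (fiber x (refl α y) p q).ncard = (fiber x (refl α' y) p q).ncard := by
    intro p q
    rw [← ncard_fiber_map hw, hwx, hwy]
  have hinner : ⟪x, refl α y⟫ = ⟪x, refl α' y⟫ := by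
    rw [← hwy, inner_map_right_of_fixed hwx]
  obtain ⟨u, hu, v, hv, huv, rfl⟩ := mem_roots_iff.1 hα
  have key : ∀ u' ∈ signedBasis n, ∀ v' ∈ signedBasis n, u' ≠ -v' → refl (u' + v') = refl α' →
      ⟪u' + v', x⟫ ≠ 0 → ⟪u' + v', y⟫ ≠ 0 → u' ∈ fiber x y ⟪u, x⟫ ⟪u, y⟫ →
      ∃ w ∈ weyl n, w x = x ∧ w y = y ∧ w (u + v) = u' + v' := by
    rintro u' hu' v' hv' huv' hr hxα' hyα' ⟨-, h₁, h₂⟩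
    obtain ⟨g, hg, hgx, hgy, hgu, -⟩ := exists_move hu hu' h₁.symm h₂.symm
    have hgv := isSigned_of_mem_weyl hg v hv
    have hgα : g (u + v) = u' + g v := by rw [map_add, hgu]
    have hgr : refl (u' + g v) y = g (refl (u + v) y) := by
      rw [map_refl, hgα, hgy]
    obtain ⟨w, hw, hwx, hwy, hwα⟩ := exists_map_eq_of_common hx hy hu' hgv hv'
      (fun h => huv (g.injective (by rw [hgu, h, map_neg]))) huv'
      (by rwa [← inner_add_left, ← hgα, inner_map_left_of_fixed hgx])
      (by rwa [← inner_add_left, ← hgα, inner_map_left_of_fixed hgy])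
      (by rwa [← inner_add_left]) (by rwa [← inner_add_left])
      (fun p q => by
        rw [hr, ← hcard, hgr]
        conv_lhs => rw [← hgx]
        exact ncard_fiber_map hg _ _ _ _)
      (by rw [hr, ← hinner, hgr, inner_map_right_of_fixed hgx])
    exact ⟨w * g, mul_mem hw hg, by rw [mul_apply, hgx, hwx], by rw [mul_apply, hgy, hwy],
      by rw [mul_apply, hgα, hwα]⟩
  obtain ⟨b, hb, hmoved⟩ := exists_moved_mem_fiber hx hy hu hv huv
    (by rwa [← inner_add_left]) (by rwa [← inner_add_left]) hcard
  obtain ⟨u', hu', v', hv', huv', rfl⟩ := mem_roots_iff.1 hα'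
  have hvu' : v' ≠ -u' := fun h => huv' (by rw [h, neg_neg])
  rcases eq_of_refl_add_ne hu' hv' hb.1 hmoved with rfl | rfl | rfl | rfl
  · obtain ⟨w, hw, h₁, h₂, h₃⟩ := key b hu' v' hv' huv' rfl hxα' hyα' hb
    exact ⟨w, hw, h₁, h₂, Or.inl h₃⟩
  · obtain ⟨w, hw, h₁, h₂, h₃⟩ := key (-u') hb.1 (-v') (neg_mem_signedBasis hv')
      (fun h => huv' (neg_injective h)) (by rw [← neg_add, refl_neg])
      (by rwa [← neg_add, inner_neg_left, neg_ne_zero])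
      (by rwa [← neg_add, inner_neg_left, neg_ne_zero]) hb
    exact ⟨w, hw, h₁, h₂, Or.inr (by rw [h₃, neg_add])⟩
  · obtain ⟨w, hw, h₁, h₂, h₃⟩ := key b hv' u' hu' hvu' (by rw [add_comm])
      (by rwa [add_comm]) (by rwa [add_comm]) hb
    exact ⟨w, hw, h₁, h₂, Or.inl (by rw [h₃, add_comm])⟩
  · obtain ⟨w, hw, h₁, h₂, h₃⟩ := key (-v') hb.1 (-u') (neg_mem_signedBasis hu')
      (fun h => hvu' (neg_injective h)) (by rw [← neg_add, refl_neg, add_comm])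
      (by rwa [← neg_add, inner_neg_left, neg_ne_zero, add_comm])
      (by rwa [← neg_add, inner_neg_left, neg_ne_zero, add_comm]) hb
    exact ⟨w, hw, h₁, h₂, Or.inr (by rw [h₃, neg_add, add_comm])⟩

/-- The orbits are not single if one vector has two equal nonzero coordinates and the other one
has both zero and nonzero coordinates. -/
theorem exists_not_singleOrbit {i j k l : Fin n} (hij : i ≠ j) (hkl : k ≠ l) (hy : y i = y j)
    (hyi : y i ≠ 0) (hxk : x k ≠ 0) (hxl : x l = 0) :
    ∃ g ∈ weyl n, ¬SingleOrbit x (g y) := by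
  -- With both vectors 0 there are no values to match, so `exists_move` is transitivity of `W` on
  -- signed basis vectors.
  obtain ⟨g₁, hg₁, -, -, h₁, -⟩ := exists_move (e_mem i) (e_mem k) (x := 0) (y := 0)
    (by simp) (by simp)
  obtain ⟨g₂, hg₂, -, -, h₂, h₂'⟩ := exists_move (isSigned_of_mem_weyl hg₁ _ (e_mem j)) (e_mem l)
    (x := 0) (y := 0) (by simp) (by simp)
  have h₃ : (g₂ * g₁) (e i) = e k := by
    rw [mul_apply, h₁, h₂']
    · rw [← h₁, inner_map, inner_e_e, if_neg hij.symm]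
    · rw [inner_e_e, if_neg hkl.symm]
  refine ⟨g₂ * g₁, mul_mem hg₂ hg₁, fun h => ?_⟩
  set z := (g₂ * g₁) y with hz
  have hzk : ⟪e k, z⟫ = y i := by rw [← h₃, hz, inner_map, inner_e_left]
  have hzl : ⟪e l, z⟫ = y i := by rw [← h₂, ← mul_apply, hz, inner_map, inner_e_left, hy]
  have hα : (2 : ℝ) • e k ∈ roots n := Or.inr ⟨k, Or.inl rfl⟩
  have hα' : e k + e l ∈ roots n := Or.inl ⟨k, l, hkl, Or.inl rfl⟩
  have hl : (2 : ℝ) • e l ∈ roots n := Or.inr ⟨l, Or.inl rfl⟩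
  have hsimple : ∀ (m : Fin n) (v : Space n),
      refl ((2 : ℝ) • e m) v = v - (2 * ⟪e m, v⟫) • e m := by
    intro m v
    rw [refl_apply, real_inner_smul_left, real_inner_smul_left, real_inner_smul_right, inner_e_e,
      if_pos rfl, smul_smul]
    congr 2
    ring
  have hnorm : ⟪(e k + e l : Space n), e k + e l⟫ = 2 := by
    rw [inner_add_add_self, inner_e_e, inner_e_e, inner_e_e, inner_e_e, if_pos rfl, if_pos rfl,
      if_neg hkl, if_neg hkl.symm]
    norm_num
  have hnorm' : ⟪((2 : ℝ) • e k : Space n), (2 : ℝ) • e k⟫ = 4 := by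
    rw [real_inner_smul_left, real_inner_smul_right, inner_e_e, if_pos rfl]
    norm_num
  -- `z` has the same value `c` at `k` and `l`. The long root turns `(c, c)` into `(-c, c)`, the
  -- short one into `(-c, -c)`, and the sign change at `l` fixes `x` and relates the two; but an
  -- isometry preserves root length.
  obtain ⟨w, -, -, -, hw⟩ := h _ hα _ hα'
    (by rw [real_inner_smul_left, inner_e_left]; exact mul_ne_zero two_ne_zero hxk)
    (by rw [real_inner_smul_left, hzk]; exact mul_ne_zero two_ne_zero hyi)
    ⟨refl ((2 : ℝ) • e l), refl_mem_weyl hl, refl_of_inner_eq_zero (by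
      rw [real_inner_smul_left, inner_e_left, hxl, mul_zero]), by
      rw [hsimple, hsimple, refl_apply, hnorm, inner_sub_right, inner_add_left, hzk, hzl,
        real_inner_smul_right, inner_e_e, if_neg hkl.symm, mul_zero, sub_zero, smul_add,
        sub_sub]
      congr 3 <;> ring_nf⟩
  have h₄ := inner_map w ((2 : ℝ) • e k) ((2 : ℝ) • e k)
  rw [hnorm'] at h₄
  rcases hw with hw | hw <;> rw [hw] at h₄
  · rw [hnorm] at h₄
    norm_num at h₄
  · rw [inner_neg_neg, hnorm] at h₄
    norm_num at h₄

end Counting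

/-! ### The coordinates of the dominant vectors and the classification -/

section Classification

variable {n : ℕ}

open Classical in
theorem lam_apply (P : Set (Fin n)) (i : Fin n) :
    lam P i = ((Finset.univ.filter fun k => k ∉ P ∧ i ≤ k).card : ℝ) := by
  rw [← inner_e_left, lam, inner_sum, Finset.card_filter, Nat.cast_sum]
  refine Finset.sum_congr rfl fun k _ => ?_
  by_cases hk : k ∈ P
  · simp [hk]
  · simp [hk, inner_e_coweight]

theorem lam_apply_nonneg (P : Set (Fin n)) (i : Fin n) : 0 ≤ lam P i := by
  rw [lam_apply]
  exact Nat.cast_nonneg _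

theorem lam_apply_ne_zero_iff {P : Set (Fin n)} {i : Fin n} :
    lam P i ≠ 0 ↔ ∃ k, k ∉ P ∧ i ≤ k := by
  rw [lam_apply, Nat.cast_ne_zero, Finset.card_ne_zero]
  simp [Finset.Nonempty]

theorem lam_apply_lt {P : Set (Fin n)} {i j : Fin n} (hij : i < j) (hi : i ∉ P) :
    lam P j < lam P i := by
  classical
  rw [lam_apply, lam_apply, Nat.cast_lt]
  refine Finset.card_lt_card ⟨fun k hk => ?_, fun h => ?_⟩
  · simp only [Finset.mem_filter, Finset.mem_univ, true_and] at hk ⊢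
    exact ⟨hk.1, hij.le.trans hk.2⟩
  · have := h (Finset.mem_filter.2 ⟨Finset.mem_univ i, hi, le_rfl⟩)
    exact absurd (Finset.mem_filter.1 this).2.2 (not_le.2 hij)

theorem lam_apply_succ {P : Set (Fin n)} {i : Fin n} (hi : i ∈ P) (h : (i : ℕ) + 1 < n) :
    lam P i = lam P ⟨i + 1, h⟩ := by
  have := inner_simpleRoot_lam_of_mem hi
  rw [simpleRoot, dif_pos h, inner_sub_left, inner_e_left, inner_e_left] at this
  exact sub_eq_zero.1 this

theorem separated_lam {P : Set (Fin n)} (hP : ∀ i ∈ P, ∀ k, i ≤ k → k ∈ P) :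
    Separated (lam P) := by
  have hinj : ∀ i j : Fin n, lam P i = lam P j → lam P i ≠ 0 → i = j := by
    intro i j h h₀
    wlog hij : i ≤ j generalizing i j
    · exact (this j i h.symm (by rwa [← h]) (le_of_not_ge hij)).symm
    rw [h, lam_apply_ne_zero_iff] at h₀
    obtain ⟨k, hk, hjk⟩ := h₀
    by_contra hne
    have hi : i ∉ P := fun hi => hk (hP i hi k (hij.trans hjk))
    exact (lam_apply_lt (lt_of_le_of_ne hij hne) hi).ne' h
  rintro b ⟨i, hb⟩ b' ⟨j, hb'⟩ h h₀
  have hi := lam_apply_nonneg P i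
  have hj := lam_apply_nonneg P j
  rcases hb with rfl | rfl <;> rcases hb' with rfl | rfl <;>
    simp only [inner_neg_left, inner_e_left] at h h₀
  · rw [hinj i j h h₀]
  · exact absurd (by linarith) h₀
  · exact absurd (by linarith) h₀
  · rw [hinj i j (by linarith) (fun h => h₀ (by rw [h, neg_zero]))]

theorem nonvanishingOnBasis_lam {P : Set (Fin n)} {m : Fin n} (hm : ∀ i, i ≤ m) (hP : m ∉ P) :
    NonvanishingOnBasis (lam P) := by
  rintro b ⟨i, rfl | rfl⟩
  · rw [inner_e_left]
    exact lam_apply_ne_zero_iff.2 ⟨m, hP, hm i⟩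
  · rw [inner_neg_left, inner_e_left, neg_ne_zero]
    exact lam_apply_ne_zero_iff.2 ⟨m, hP, hm i⟩

theorem lam_univ : lam (Set.univ : Set (Fin n)) = 0 := by
  simp [lam]

theorem inner_lam_empty_injective {m : Fin n} (hm : ∀ i, i ≤ m) :
    ∀ b ∈ signedBasis n, ∀ b' ∈ signedBasis n,
      ⟪b, lam (∅ : Set (Fin n))⟫ = ⟪b', lam ∅⟫ → b = b' := fun b hb b' hb' h =>
  separated_lam (by simp) b hb b' hb' h (nonvanishingOnBasis_lam hm (Set.notMem_empty m) b hb)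

/-- If `lam P` has no repeated nonzero coordinates, then `P` is closed upwards. -/
theorem mem_of_le_of_lam_injective {P : Set (Fin n)}
    (h : ∀ i j : Fin n, i ≠ j → lam P i = lam P j → lam P i = 0) :
    ∀ i ∈ P, ∀ k, i ≤ k → k ∈ P := by
  intro i hi k hik
  by_contra hk
  have hne : i ≠ k := fun h => hk (h ▸ hi)
  have hlt : (i : ℕ) < k := lt_of_le_of_ne hik fun h => hne (Fin.ext h)
  have hsucc : (i : ℕ) + 1 < n := lt_of_le_of_lt hlt k.2
  exact lam_apply_ne_zero_iff.2 ⟨k, hk, hik⟩ (h i ⟨i + 1, hsucc⟩ (by simp [Fin.ext_iff])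
    (lam_apply_succ hi hsucc))

theorem exists_eq_Ici {P : Set (Fin n)} (hP : P.Nonempty) (h : ∀ i ∈ P, ∀ k, i ≤ k → k ∈ P) :
    ∃ p, P = Set.Ici p := by
  obtain ⟨p, hp, hmin⟩ := Set.exists_min_image P id P.toFinite hP
  exact ⟨p, Set.Subset.antisymm (fun k hk => hmin k hk) fun k hk => h p hp k hk⟩

theorem lam_apply_last {P : Set (Fin n)} {m : Fin n} (hm : ∀ i, i ≤ m) (h : m ∈ P) :
    lam P m = 0 := by
  by_contra hne
  obtain ⟨k, hk, hmk⟩ := lam_apply_ne_zero_iff.1 hne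
  exact hk (le_antisymm hmk (hm k) ▸ h)

/-- If all orbits are single and `P ≠ Θ` contains the long simple root, then `Q` is closed
upwards. -/
theorem mem_of_le_of_singleOrbit {P Q : Set (Fin n)} {m : Fin n} (hm : ∀ i, i ≤ m)
    (h : ∀ u ∈ weyl n, SingleOrbit (lam P) (u (lam Q))) (hmP : m ∈ P) (hP : P ≠ Set.univ) :
    ∀ i ∈ Q, ∀ k, i ≤ k → k ∈ Q := by
  refine mem_of_le_of_lam_injective fun i j hij heq => ?_
  by_contra hne
  obtain ⟨k, hk⟩ := (Set.ne_univ_iff_exists_notMem P).1 hP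
  obtain ⟨g, hg, hns⟩ := exists_not_singleOrbit hij (k := k) (l := m)
    (fun hkm => hk (hkm.symm ▸ hmP)) heq hne
    (lam_apply_ne_zero_iff.2 ⟨k, hk, le_rfl⟩) (lam_apply_last hm hmP)
  exact hns (h g hg)

theorem singleOrbit_lam_symm {P Q : Set (Fin n)}
    (h : ∀ u ∈ weyl n, SingleOrbit (lam P) (u (lam Q))) :
    ∀ u ∈ weyl n, SingleOrbit (lam Q) (u (lam P)) := by
  intro u hu
  have := (h u⁻¹ (inv_mem hu)).symm.map hu
  rwa [apply_inv_self] at this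

/-- The obstruction is applied twice: it makes `Q` closed upwards, so the nonempty `Q` contains the
last index, and the same argument then applies to `P`. -/
theorem exists_Ici_of_singleOrbit {P Q : Set (Fin n)} {m : Fin n} (hm : ∀ i, i ≤ m)
    (h : ∀ u ∈ weyl n, SingleOrbit (lam P) (u (lam Q))) (hmP : m ∈ P) (hP : P ≠ Set.univ)
    (hQ : Q ≠ Set.univ) (hQ' : Q.Nonempty) :
    ∃ p q : Fin n, P = Set.Ici p ∧ Q = Set.Ici q := by
  have hQup := mem_of_le_of_singleOrbit hm h hmP hP
  obtain ⟨q, hq⟩ := hQ'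
  have hPup := mem_of_le_of_singleOrbit hm (singleOrbit_lam_symm h) (hQup q hq m (hm q)) hQ
  obtain ⟨p, hp⟩ := exists_eq_Ici ⟨m, hmP⟩ hPup
  obtain ⟨q, hq⟩ := exists_eq_Ici ⟨q, hq⟩ hQup
  exact ⟨p, q, hp, hq⟩

theorem singleOrbit_lam_iff {P Q : Set (Fin n)} {m : Fin n} (hm : ∀ i, i ≤ m) :
    (∀ u ∈ weyl n, SingleOrbit (lam Q) (u (lam P))) ↔
      ((∃ p q : Fin n, P = Set.Ici p ∧ Q = Set.Ici q) ∨ (m ∉ P ∧ m ∉ Q) ∨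
        (P = Set.univ ∨ Q = Set.univ) ∨ (P = ∅ ∨ Q = ∅)) := by
  constructor
  · intro h
    by_contra! hc
    obtain ⟨h₁, h₂, ⟨hP, hQ⟩, hP', hQ'⟩ := hc
    by_cases hmP : m ∈ P
    · obtain ⟨p, q, hp, hq⟩ :=
        exists_Ici_of_singleOrbit hm (singleOrbit_lam_symm h) hmP hP hQ hQ'
      exact h₁ p q hp hq
    · obtain ⟨q, p, hq, hp⟩ := exists_Ici_of_singleOrbit hm h (h₂ hmP) hQ hP hP'
      exact h₁ p q hp hq
  · rintro (⟨p, q, rfl, rfl⟩ | ⟨hP, hQ⟩ | (rfl | rfl) | rfl | rfl) u hu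
    · exact (separated_lam fun _ hi _ hk => le_trans hi hk).singleOrbit
        ((separated_lam fun _ hi _ hk => le_trans hi hk).map hu)
    · exact (nonvanishingOnBasis_lam hm hQ).singleOrbit ((nonvanishingOnBasis_lam hm hP).map hu)
    · rw [lam_univ, map_zero]
      exact singleOrbit_zero_right _
    · rw [lam_univ]
      exact singleOrbit_zero_left _
    · refine singleOrbit_of_injective fun b hb b' hb' h => ?_
      rw [inner_map_right, inner_map_right] at h
      have hu' := isSigned_of_mem_weyl (inv_mem hu)
      exact (u⁻¹).injective (inner_lam_empty_injective hm _ (hu' b hb) _ (hu' b' hb') h)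
    · exact (singleOrbit_of_injective (inner_lam_empty_injective hm)).symm

end Classification

end TypeC

end

theorem mainTheorem8 (n : ℕ) (hn : 2 ≤ n) (P Q : Set (Fin n))
    (D : TypeC.DoubleMomentGraph Q P) :
    D.IsClosed ↔
      ((∃ p q : Fin n, P = Set.Ici p ∧ Q = Set.Ici q) ∨
        ((⟨n - 1, by omega⟩ : Fin n) ∉ P ∧ (⟨n - 1, by omega⟩ : Fin n) ∉ Q) ∨
        (P = Set.univ ∨ Q = Set.univ) ∨
        (P = ∅ ∨ Q = ∅)) := by
  rw [D.isClosed_iff]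
  exact TypeC.singleOrbit_lam_iff fun i => Fin.le_def.2 (Nat.le_sub_one_of_lt i.2)
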